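/- Conventions. Let $m,N_S\in\mathbb N$ with $N_S\ge 1$, and let $\hat{\mathbf R}$ be the vector of the $2m$ position and momentum operators on the $m$-mode Hilbert space $L^2(\mathbb R^m)$, with $[\hat{\mathbf R},\hat{\mathbf R}^{\top}]=i\Omega\mathbb 1$, where $\Omega$ is the canonical symplectic form, and let $\mathrm{Sp}_{2m}(\mathbb R)=\{S\in\mathbb R^{2m\times 2m}: S^{\top}\Omega S=\Omega\}$. For $\mathbf r\in\mathbb R^{2m}$ let $D_{\mathbf r}=e^{-i\mathbf r^{\top}\Omega\hat{\mathbf R}}$ be the displacement operator and $|\mathbf r\rangle=D_{\mathbf r}|0\rangle$ the coherent state with first moment $\mathbf r$, where $|0\rangle$ is the vacuum. For $S\in\mathrm{Sp}_{2m}(\mathbb R)$ let $U_S$ be a unitary with $U_SD_{\boldsymbol\xi}U_S^\dagger=D_{S\boldsymbol\xi}$ for all $\boldsymbol\xi\in\mathbb R^{2m}$ (equivalently $U_S^\dagger\hat{\mathbf R}U_S=S\hat{\mathbf R}$; it is unique up to a phase), and let $G_{\mathbf r,S}=D_{\mathbf r}U_S$ be the Gaussian unitary with parameters $(\mathbf r,S)$.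 Heterodyne detection of a pure state $\psi$ returns $\mathbf q\in\mathbb R^{2m}$ with probability density $(2\pi)^{-m}|\langle \mathbf q|\psi\rangle|^2$. $\|\cdot\|_\infty$ is the operator (spectral) norm of a matrix, $e_i$ is the $i$-th standard basis vector of $\mathbb R^{2m}$, and $S_i=Se_i$. Lemma (query complexity for learning the symplectic part with symmetric probes). Let $\mathbf r\in\mathbb R^{2m}$, $S\in\mathrm{Sp}_{2m}(\mathbb R)$ and $\eta>0$, and put $\Sigma=\tfrac12(SS^{\top}+\mathbb 1)$. For every $i\in[2m]$ and each sign $\pm$, let $Y_{i,\pm}^{(1)},\dots,Y_{i,\pm}^{(N_S)}$ be heterodyne samples of $G_{\mathbf r,S}|\pm\eta e_i\rangle$, all $4mN_S$ samples being mutually independent. Define $$\bar Y_i^{(\pm)}=\frac1{N_S}\sum_{k=1}^{N_S}Y_{i,\pm}^{(k)},\qquad \hat S_i=\frac{\bar Y_i^{(+)}-\bar Y_i^{(-)}}{2\eta},\qquad \hat S=[\hat S_1,\dots,\hat S_{2m}].$$ Then: 1. each sample $Y_{i,\pm}^{(k)}$ has law $\mathcal N(\mathbf r\pm\eta S_i,\Sigma)$;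 2. the column errors $\hat S_1-S_1,\dots,\hat S_{2m}-S_{2m}$ are mutually independent, and each has law $\mathcal N\bigl(0,\tfrac{1}{2\eta^2N_S}\Sigma\bigr)$; 3. for every $\varepsilon>0$ and $\delta\in(0,1)$, if $$N_S\ \ge\ \frac{\|S\|_\infty^2\bigl(2\sqrt{2m}+\sqrt{2\log(1/\delta)}\bigr)^2}{2\eta^2\varepsilon^2},$$ then $\Pr\bigl[\|\hat S-S\|_\infty\le\varepsilon\bigr]\ge 1-\delta$; 4. the scheme uses $G_{\mathbf r,S}$ once for each sample, hence $4mN_S$ queries in total. -/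

import Mathlib

open MeasureTheory ProbabilityTheory

noncomputable section

namespace CV

/-- Position (configuration) space `ℝ^m` with its Euclidean structure and Lebesgue measure. -/
abbrev Config (m : ℕ) := EuclideanSpace ℝ (Fin m)

/-- Phase space `ℝ^{2m}`. The index `Sum.inl j` is the position and `Sum.inr j` the momentum
quadrature of mode `j`. -/
abbrev Phase (m : ℕ) := EuclideanSpace ℝ (Fin m ⊕ Fin m)

/-- The `m`-mode Hilbert space `L²(ℝ^m)`. -/
abbrev Hilb (m : ℕ) := Lp ℂ 2 (volume : Measure (Config m))

/-- Real `2m × 2m` matrices. -/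
abbrev PMatrix (m : ℕ) := Matrix (Fin m ⊕ Fin m) (Fin m ⊕ Fin m) ℝ

/-- Operator (spectral) norm of a matrix, i.e. its norm as an operator on Euclidean space. -/
def opNorm {m : ℕ} (A : PMatrix m) : ℝ := ‖Matrix.toEuclideanCLM (𝕜 := ℝ) A‖

/-- The linear action of a matrix on phase space. -/
def act {m : ℕ} (A : PMatrix m) (ξ : Phase m) : Phase m := Matrix.toEuclideanCLM (𝕜 := ℝ) A ξ

/-- Position part of a phase-space vector. -/
def posPart {m : ℕ} (ξ : Phase m) : Config m := WithLp.toLp 2 fun j => ξ (Sum.inl j)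

/-- Momentum part of a phase-space vector. -/
def momPart {m : ℕ} (ξ : Phase m) : Config m := WithLp.toLp 2 fun j => ξ (Sum.inr j)

/-- The phase `exp (i (p ⬝ y - p ⬝ x / 2))` of the displacement operator for `ξ = (x, p)`. -/
def weylPhase {m : ℕ} (ξ : Phase m) (y : Config m) : ℂ :=
  Complex.exp (Complex.I *
    ((inner ℝ (momPart ξ) y - inner ℝ (momPart ξ) (posPart ξ) / 2 : ℝ) : ℂ))

lemma norm_weylPhase {m : ℕ} (ξ : Phase m) (y : Config m) : ‖weylPhase ξ y‖ = 1 := by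
  rw [weylPhase, mul_comm, Complex.norm_exp_ofReal_mul_I]

lemma continuous_weylPhase {m : ℕ} (ξ : Phase m) : Continuous (weylPhase ξ) := by
  unfold weylPhase
  fun_prop

lemma memLp_displace {m : ℕ} (ξ : Phase m) (ψ : Hilb m) :
    MemLp (fun y => weylPhase ξ y * ψ (y - posPart ξ)) 2 (volume : Measure (Config m)) := by
  have h : MemLp (fun y => ψ (y - posPart ξ)) 2 (volume : Measure (Config m)) :=
    (Lp.memLp ψ).comp_measurePreserving (measurePreserving_sub_right volume (posPart ξ))
  refine h.of_le
    ((continuous_weylPhase ξ).aestronglyMeasurable.mul h.aestronglyMeasurable) ?_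
  exact Filter.Eventually.of_forall fun y => by simp [norm_weylPhase]

/-- The displacement (Weyl) operator `D_ξ = exp (-i ξᵀ Ω R̂)` with `R̂ = (x̂, p̂)` and
`[x̂_j, p̂_k] = i δ_jk`. In the Schroedinger representation and for `ξ = (x, p)` it is
`(D_ξ ψ)(y) = exp (i (p ⬝ y - p ⬝ x / 2)) ψ (y - x)`. -/
def displace {m : ℕ} (ξ : Phase m) (ψ : Hilb m) : Hilb m := (memLp_displace ξ ψ).toLp

/-- The wave function `π^{-m/4} exp (-|y|² / 2)` of the vacuum. -/
def vacuumFun (m : ℕ) (y : Config m) : ℂ :=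
  ((Real.pi ^ (-(m : ℝ) / 4) * Real.exp (-‖y‖ ^ 2 / 2) : ℝ) : ℂ)

lemma memLp_vacuumFun (m : ℕ) : MemLp (vacuumFun m) 2 (volume : Measure (Config m)) := by
  have hc : Continuous (vacuumFun m) := by
    unfold vacuumFun
    fun_prop
  rw [memLp_two_iff_integrable_sq_norm hc.aestronglyMeasurable]
  have h := (GaussianFourier.integrable_cexp_neg_mul_sq_norm_add (V := Config m) (b := 1)
    (by simp) 0 0).norm.const_mul ((Real.pi ^ (-(m : ℝ) / 4)) ^ 2)
  refine h.congr (Filter.Eventually.of_forall fun y => ?_)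
  simp only [vacuumFun, Complex.norm_exp, Complex.norm_real, Real.norm_eq_abs, sq_abs, mul_pow]
  congr 1
  rw [← Real.exp_nat_mul]
  congr 1
  have : ((-1 : ℂ) * (‖y‖ : ℂ) ^ 2 + 0 * ((inner ℝ (0 : Config m) y : ℝ) : ℂ)).re = -‖y‖ ^ 2 := by
    rw [zero_mul, add_zero, ← Complex.ofReal_pow, neg_one_mul, Complex.neg_re, Complex.ofReal_re]
  rw [this]
  push_cast
  ring

/-- The vacuum state `|0⟩`. -/
def vacuum (m : ℕ) : Hilb m := (memLp_vacuumFun m).toLp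

/-- The coherent state `|ξ⟩ = D_ξ |0⟩`. Its first moment is `ξ` and its covariance matrix
(normalised so that the vacuum has covariance `1`) is the identity. -/
def coherent {m : ℕ} (ξ : Phase m) : Hilb m := displace ξ (vacuum m)

/-- `U` is a symplectic Gaussian unitary `U_S`, that is `U† R̂ U = S R̂`. In exponentiated (Weyl)
form, which needs no domains of unbounded operators, this reads `U D_ξ U† = D_{S ξ}`. -/
def IsSymplecticUnitary {m : ℕ} (S : PMatrix m) (U : Hilb m ≃ₗᵢ[ℂ] Hilb m) : Prop :=
  ∀ (ξ : Phase m) (ψ : Hilb m), U (displace ξ ψ) = displace (act S ξ) (U ψ)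

/-- `G` is a Gaussian unitary `G_{r,S} = D_r U_S`. -/
def IsGaussianUnitary {m : ℕ} (r : Phase m) (S : PMatrix m) (G : Hilb m ≃ₗᵢ[ℂ] Hilb m) : Prop :=
  ∃ U : Hilb m ≃ₗᵢ[ℂ] Hilb m, IsSymplecticUnitary S U ∧ ∀ ψ, G ψ = displace r (U ψ)

/-- The law of the outcome `q ∈ ℝ^{2m}` of heterodyne detection on the pure state `ψ`: the Born
rule for the coherent-state measurement with density `(2π)^{-m} |q⟩⟨q| dq`. -/
def heterodyneLaw {m : ℕ} (ψ : Hilb m) : Measure (Phase m) :=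
  volume.withDensity fun q => ENNReal.ofReal (‖inner ℂ (coherent q) ψ‖ ^ 2 / (2 * Real.pi) ^ m)

/-- A scheme that probes an unknown unitary with coherent states. In each shot one coherent state
is prepared, the unitary is applied once, and the output is measured by heterodyne detection. -/
structure ProbeScheme (m : ℕ) where
  Shot : Type
  fintypeShot : Fintype Shot
  probe : Shot → Phase m

/-- Number of queries to the unknown unitary: one for each shot. -/
def ProbeScheme.queryCount {m : ℕ} (A : ProbeScheme m) : ℕ := @Fintype.card A.Shot A.fintypeShot

/-- The random vectors `Y s` are the outcomes of running the scheme on the unitary `G`: they are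
mutually independent, and `Y s` is a heterodyne sample of `G |probe s⟩`. -/
def ProbeScheme.IsRecord {m : ℕ} (A : ProbeScheme m) (G : Hilb m ≃ₗᵢ[ℂ] Hilb m)
    {Ω : Type*} [MeasurableSpace Ω] (P : Measure Ω) (Y : A.Shot → Ω → Phase m) : Prop :=
  iIndepFun Y P ∧ ∀ s, HasLaw (Y s) (heterodyneLaw (G (coherent (A.probe s)))) P

/-- Labels `(i, σ, k)` of the shots of the symmetric-probe scheme: column, sign, repetition. -/
abbrev SymShot (m N : ℕ) := (Fin m ⊕ Fin m) × ℤˣ × Fin N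

/-- The symmetric-probe scheme: for every `i` and each sign, `N` shots with probe `|± η e_i⟩`. -/
def symmetricScheme (m N : ℕ) (η : ℝ) : ProbeScheme m where
  Shot := SymShot m N
  fintypeShot := inferInstance
  probe := fun s => EuclideanSpace.single s.1 (((s.2.1 : ℤ) : ℝ) * η)

/-- Empirical mean of the `N` samples obtained from the probe `|σ η e_i⟩`. -/
def batchMean {m N : ℕ} {Ω : Type*} (Y : SymShot m N → Ω → Phase m) (i : Fin m ⊕ Fin m) (σ : ℤˣ)
    (ω : Ω) : Phase m :=
  (N : ℝ)⁻¹ • ∑ k : Fin N, Y (i, σ, k) ω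

/-- The column estimator, i.e. the difference of the two batch means divided by `2η`. -/
def columnEstimator {m N : ℕ} {Ω : Type*} (η : ℝ) (Y : SymShot m N → Ω → Phase m)
    (i : Fin m ⊕ Fin m) (ω : Ω) : Phase m :=
  (2 * η)⁻¹ • (batchMean Y i 1 ω - batchMean Y i (-1) ω)

/-- The matrix estimator, whose `i`-th column is the `i`-th column estimator. -/
def matrixEstimator {m N : ℕ} {Ω : Type*} (η : ℝ) (Y : SymShot m N → Ω → Phase m) (ω : Ω) :
    PMatrix m :=
  Matrix.of fun a i => columnEstimator η Y i ω a

/-- The `i`-th column of a matrix, as a vector of phase space. -/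
def column {m : ℕ} (A : PMatrix m) (i : Fin m ⊕ Fin m) : Phase m := WithLp.toLp 2 fun a => A a i

/-- The heterodyne noise covariance `(S Sᵀ + 1) / 2`. -/
def noiseCov {m : ℕ} (S : PMatrix m) : PMatrix m := (2 : ℝ)⁻¹ • (S * S.transpose + 1)

end CV

end

-- Law of a sample. The heterodyne density of a state is its Husimi function, whose characteristic
-- function at k is exp(-|k|²/4) times the expectation of the Weyl operator D_{Jk}
-- (`charFun_heterodyneLaw`). In the state D_r U_S |ξ⟩ the displacements only contribute phases,
-- which encode the mean r + Sξ. The relation S J Sᵀ = J then moves D_{Jk} through U_S, leaving the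
-- vacuum expectation exp(-|Sᵀk|²/4). The product is the Gaussian characteristic function with
-- covariance (SSᵀ + 1)/2 (`heterodyneLaw_gaussianUnitary`).
--
-- Column errors. Each is a signed, scaled sum of 2N independent centred samples, opposite probes
-- cancelling r. Different columns use disjoint blocks of shots, hence are independent.
--
-- Operator norm. The error matrix has the law of √(cΣ) G, with c = 1/(2η²N) and G a square standard
-- Gaussian matrix of size 2m. Since ‖S‖ ≥ 1 for symplectic S (m > 0), ‖√Σ‖ ≤ ‖S‖, and what remains
-- is P(‖G‖ > 2√(2m) + τ) ≤ exp(-τ²/2) (`stdGaussian_norm_gaussMatrix_gt_le`). This is Chevet's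
-- inequality in exponential-moment form. For unit u, v, the process ⟨u, Gv⟩ plus an independent
-- standard normal has the variances of ⟨u, g⟩ + ⟨v, h⟩ and covariances at least as large. Slepian's
-- comparison gives exp(l²/2) E exp(l max ⟨u, Gv⟩) ≤ E exp(l max(⟨u, g⟩ + ⟨v, h⟩))
-- (`exp_mul_integral_expSum_le`). There exp(l max) is smoothed to the power p of a partition
-- function at inverse temperature β with pβ = l; letting p → 0 removes the cardinality of the
-- finite index set.

open scoped RealInnerProductSpace

noncomputable section

namespace CV

-- Standard Gaussian measure: density, integration by parts, exponential integrability.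

section StdGaussian

variable {E : Type*} [NormedAddCommGroup E] [InnerProductSpace ℝ E]

/-- The Lebesgue density of the standard Gaussian measure. -/
def stdGaussianDensity (E : Type*) [NormedAddCommGroup E] [InnerProductSpace ℝ E] (x : E) : ℝ :=
  (2 * Real.pi) ^ (-(Module.finrank ℝ E : ℝ) / 2) * Real.exp (-‖x‖ ^ 2 / 2)

lemma stdGaussianDensity_nonneg (x : E) : 0 ≤ stdGaussianDensity E x := by
  unfold stdGaussianDensity; positivity

lemma continuous_stdGaussianDensity : Continuous (stdGaussianDensity E) := by
  unfold stdGaussianDensity; fun_prop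

lemma hasLineDerivAt_stdGaussianDensity (x v : E) :
    HasLineDerivAt ℝ (stdGaussianDensity E) (-(stdGaussianDensity E x * ⟪v, x⟫)) x v := by
  have h : HasFDerivAt (stdGaussianDensity E) _ x :=
    ((((hasStrictFDerivAt_norm_sq x).hasFDerivAt.neg).mul_const ((2 : ℝ)⁻¹)).exp).const_mul
      ((2 * Real.pi) ^ (-(Module.finrank ℝ E : ℝ) / 2))
  convert! h.hasLineDerivAt v using 1
  simp [stdGaussianDensity, real_inner_comm, div_eq_mul_inv]
  ring

variable [FiniteDimensional ℝ E] [MeasurableSpace E] [BorelSpace E]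

lemma integrable_stdGaussianDensity : Integrable (stdGaussianDensity E) := by
  have h := (GaussianFourier.integrable_cexp_neg_mul_sq_norm_add (V := E) (b := 1 / 2)
    (by norm_num) 0 0).norm.const_mul ((2 * Real.pi) ^ (-(Module.finrank ℝ E : ℝ) / 2))
  refine h.congr (Filter.Eventually.of_forall fun y => ?_)
  simp only [stdGaussianDensity, Complex.norm_exp]
  congr 2
  have : (-(1 / 2 : ℂ) * (‖y‖ : ℂ) ^ 2 + 0 * ((⟪(0 : E), y⟫ : ℝ) : ℂ)) =
      ((-‖y‖ ^ 2 / 2 : ℝ) : ℂ) := by push_cast; ring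
  rw [this, Complex.ofReal_re]

/-- Both characteristic functions are exp(-‖t‖²/2). The explicit density is what turns Lebesgue
integration by parts into Stein's identity. -/
lemma stdGaussian_eq_withDensity :
    stdGaussian E = volume.withDensity fun x => ENNReal.ofReal (stdGaussianDensity E x) := by
  have hfin : IsFiniteMeasure (volume.withDensity fun x : E =>
      ENNReal.ofReal (stdGaussianDensity E x)) :=
    isFiniteMeasure_withDensity_ofReal integrable_stdGaussianDensity.2
  refine Measure.ext_of_charFun (funext fun t => ?_)
  rw [charFun_stdGaussian, charFun_apply,
    integral_withDensity_eq_integral_toReal_smul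
      (continuous_stdGaussianDensity.measurable.ennreal_ofReal) (by simp)]
  have h := GaussianFourier.integral_cexp_neg_mul_sq_norm_add (V := E) (b := 1 / 2)
    (by norm_num) Complex.I t
  have hπ : (0 : ℝ) < 2 * Real.pi := by positivity
  calc Complex.exp (-‖t‖ ^ 2 / 2)
      = (((2 * Real.pi) ^ (-(Module.finrank ℝ E : ℝ) / 2) : ℝ) : ℂ) *
        (((Real.pi : ℂ) / (1 / 2)) ^ (Module.finrank ℝ E / 2 : ℂ) *
          Complex.exp (Complex.I ^ 2 * ‖t‖ ^ 2 / (4 * (1 / 2)))) := by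
        rw [← mul_assoc]
        have : (Real.pi : ℂ) / (1 / 2) = ((2 * Real.pi : ℝ) : ℂ) := by push_cast; ring
        rw [this, Complex.ofReal_cpow hπ.le, ← Complex.cpow_add _ _ (by exact_mod_cast hπ.ne')]
        rw [show ((-(Module.finrank ℝ E : ℝ) / 2 : ℝ) : ℂ) + (Module.finrank ℝ E / 2 : ℂ) = 0 by
          push_cast; ring]
        rw [Complex.cpow_zero, one_mul, Complex.I_sq]
        congr 1; ring
    _ = _ := by
        rw [← h, ← integral_const_mul]
        refine integral_congr_ae (Filter.Eventually.of_forall fun x => ?_)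
        beta_reduce
        rw [ENNReal.toReal_ofReal (stdGaussianDensity_nonneg x), stdGaussianDensity,
          Complex.real_smul]
        push_cast
        rw [mul_assoc, ← Complex.exp_add, real_inner_comm]
        congr 2
        ring

lemma integral_stdGaussian (f : E → ℝ) :
    ∫ x, f x ∂(stdGaussian E) = ∫ x, stdGaussianDensity E x * f x := by
  rw [stdGaussian_eq_withDensity, integral_withDensity_eq_integral_toReal_smul
      (continuous_stdGaussianDensity.measurable.ennreal_ofReal) (by simp)]
  simp [ENNReal.toReal_ofReal (stdGaussianDensity_nonneg _)]

lemma integrable_stdGaussian_iff (f : E → ℝ) :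
    Integrable f (stdGaussian E) ↔ Integrable fun x => stdGaussianDensity E x * f x := by
  rw [stdGaussian_eq_withDensity, integrable_withDensity_iff_integrable_smul'
      (continuous_stdGaussianDensity.measurable.ennreal_ofReal) (by simp)]
  simp [ENNReal.toReal_ofReal (stdGaussianDensity_nonneg _)]

/-- Gaussian integration by parts (Stein's identity). -/
lemma integral_inner_mul_stdGaussian {h h' : E → ℝ} {v : E}
    (hd : ∀ x, HasLineDerivAt ℝ h (h' x) x v) (hi : Integrable h (stdGaussian E))
    (hi' : Integrable h' (stdGaussian E))
    (hvi : Integrable (fun x => ⟪v, x⟫ * h x) (stdGaussian E)) :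
    ∫ x, ⟪v, x⟫ * h x ∂(stdGaussian E) = ∫ x, h' x ∂(stdGaussian E) := by
  rw [integrable_stdGaussian_iff] at hi hi' hvi
  have := integral_bilinear_hasLineDerivAt_right_eq_neg_left_of_integrable (μ := volume)
    (f := stdGaussianDensity E) (f' := fun x => -(stdGaussianDensity E x * ⟪v, x⟫))
    (g := h) (g' := h') (v := v) (B := ContinuousLinearMap.mul ℝ ℝ)
    (by
      refine hvi.neg.congr (Filter.Eventually.of_forall fun x => ?_)
      simp; ring)
    (by simpa using hi') (by simpa using hi)
    (fun x _ => hasLineDerivAt_stdGaussianDensity x v) (fun x _ => hd x)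
  rw [integral_stdGaussian, integral_stdGaussian]
  simp only [ContinuousLinearMap.mul_apply'] at this
  rw [this, ← integral_neg]
  congr 1; ext x; ring

/-- Fernique's theorem gives a Gaussian moment exp(C‖x‖²), and completing the square absorbs the
linear exponent. -/
lemma integrable_exp_mul_norm_stdGaussian (a : ℝ) :
    Integrable (fun x : E => Real.exp (a * ‖x‖)) (stdGaussian E) := by
  obtain ⟨C, hC, hint⟩ := IsGaussian.exists_integrable_exp_sq (stdGaussian E)
  refine (hint.const_mul (Real.exp (a ^ 2 / (4 * C)))).mono'
    (by fun_prop) (Filter.Eventually.of_forall fun x => ?_)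
  rw [Real.norm_eq_abs, abs_of_pos (Real.exp_pos _), ← Real.exp_add]
  apply Real.exp_le_exp.2
  have : a ^ 2 / (4 * C) + C * ‖x‖ ^ 2 - a * ‖x‖ = (a - 2 * C * ‖x‖) ^ 2 / (4 * C) := by
    field_simp; ring
  have : 0 ≤ (a - 2 * C * ‖x‖) ^ 2 / (4 * C) := by positivity
  linarith

lemma integrable_norm_mul_exp_mul_norm_stdGaussian (a : ℝ) :
    Integrable (fun x : E => ‖x‖ * Real.exp (a * ‖x‖)) (stdGaussian E) := by
  refine (integrable_exp_mul_norm_stdGaussian (a + 1)).mono'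
    (by fun_prop) (Filter.Eventually.of_forall fun x => ?_)
  rw [norm_mul, norm_norm, Real.norm_eq_abs, abs_of_pos (Real.exp_pos _), add_mul, Real.exp_add,
    mul_comm]
  gcongr
  linarith [Real.add_one_le_exp (1 * ‖x‖)]

end StdGaussian

-- Powers of the partition function and their derivatives.

section SoftMax

variable {E : Type*} [NormedAddCommGroup E] [InnerProductSpace ℝ E] {T : Type*} [Fintype T]

/-- The partition function `∑ t, exp (β ⟪c t, z⟫)`, whose powers are smooth substitutes for the
exponential of `max_t ⟪c t, z⟫`. -/
def expSum (β : ℝ) (c : T → E) (z : E) : ℝ := ∑ t, Real.exp (β * ⟪c t, z⟫)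

lemma exp_le_expSum (β : ℝ) (c : T → E) (z : E) (t : T) :
    Real.exp (β * ⟪c t, z⟫) ≤ expSum β c z :=
  Finset.single_le_sum (f := fun t => Real.exp (β * ⟪c t, z⟫)) (fun _ _ => (Real.exp_pos _).le)
    (Finset.mem_univ t)

lemma expSum_le {β : ℝ} {c : T → E} {z : E} {M : ℝ} (h : ∀ t, β * ⟪c t, z⟫ ≤ M) :
    expSum β c z ≤ Fintype.card T * Real.exp M := by
  refine (Finset.sum_le_sum fun t _ => Real.exp_le_exp.2 (h t)).trans ?_
  simp

lemma expSum_nonneg (β : ℝ) (c : T → E) (z : E) : 0 ≤ expSum β c z :=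
  Finset.sum_nonneg fun _ _ => (Real.exp_pos _).le

lemma expSum_rpow_le {β p : ℝ} (hp : 0 ≤ p) {c : T → E} {z : E} {M : ℝ}
    (h : ∀ t, β * ⟪c t, z⟫ ≤ M) :
    expSum β c z ^ p ≤ (Fintype.card T : ℝ) ^ p * Real.exp (p * M) := by
  refine (Real.rpow_le_rpow (expSum_nonneg β c z) (expSum_le h) hp).trans_eq ?_
  rw [Real.mul_rpow (by positivity) (Real.exp_pos _).le, ← Real.exp_mul, mul_comm M]

lemma expSum_rpow_le_norm {β p R : ℝ} (hβ : 0 ≤ β) (hp : 0 ≤ p) {c : T → E} (z : E)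
    (hR : ∀ t, ‖c t‖ ≤ R) :
    expSum β c z ^ p ≤ (Fintype.card T : ℝ) ^ p * Real.exp (p * β * R * ‖z‖) := by
  refine (expSum_rpow_le hp (M := β * (R * ‖z‖)) fun t => ?_).trans_eq (by ring_nf)
  gcongr
  exact (real_inner_le_norm _ _).trans (by gcongr; exact hR t)

lemma hasLineDerivAt_expSum (β : ℝ) (c : T → E) (z v : E) :
    HasLineDerivAt ℝ (expSum β c) (∑ s, Real.exp (β * ⟪c s, z⟫) * (β * ⟪c s, v⟫)) z v := by
  have h : ∀ s, HasFDerivAt (fun z => Real.exp (β * ⟪c s, z⟫)) _ z := fun s =>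
    (((innerSL ℝ (c s)).hasFDerivAt (x := z)).const_mul β).exp
  convert! (HasFDerivAt.fun_sum (u := Finset.univ) fun s _ => h s).hasLineDerivAt v using 1
  simp [innerSL_apply_apply]

lemma continuous_expSum (β : ℝ) (c : T → E) : Continuous (expSum β c) := by
  unfold expSum; fun_prop

variable [Nonempty T]

lemma expSum_pos (β : ℝ) (c : T → E) (z : E) : 0 < expSum β c z :=
  Finset.sum_pos (fun _ _ => Real.exp_pos _) Finset.univ_nonempty

lemma continuous_expSum_rpow (β : ℝ) (c : T → E) (q : ℝ) :
    Continuous fun z => expSum β c z ^ q :=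
  (continuous_expSum β c).rpow_const fun z => Or.inl (expSum_pos β c z).ne'

lemma exp_mul_expSum_rpow_le (β p : ℝ) (c : T → E) (z : E) (t : T) :
    Real.exp (β * ⟪c t, z⟫) * expSum β c z ^ (p - 1) ≤ expSum β c z ^ p := by
  have hS := expSum_pos β c z
  calc _ ≤ expSum β c z * expSum β c z ^ (p - 1) := by
        gcongr; exact exp_le_expSum β c z t
    _ = _ := by rw [Real.rpow_sub_one hS.ne']; field_simp

/-- The `t`-th summand of the gradient of `expSum β c ^ p`, without the factor `p β`. -/
def expSumGrad (β p : ℝ) (c : T → E) (t : T) (z : E) : ℝ :=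
  Real.exp (β * ⟪c t, z⟫) * expSum β c z ^ (p - 1)

/-- The derivative of `expSumGrad β p c t` in the direction `v`. -/
def expSumHess (β p : ℝ) (c : T → E) (t : T) (v z : E) : ℝ :=
  β * ⟪c t, v⟫ * expSumGrad β p c t z +
    (p - 1) * (Real.exp (β * ⟪c t, z⟫) * expSum β c z ^ (p - 2)) *
      ∑ s, Real.exp (β * ⟪c s, z⟫) * (β * ⟪c s, v⟫)

lemma hasLineDerivAt_expSumGrad (β p : ℝ) (c : T → E) (t : T) (z v : E) :
    HasLineDerivAt ℝ (expSumGrad β p c t) (expSumHess β p c t v z) z v := by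
  have h1 : HasFDerivAt (fun z => Real.exp (β * ⟪c t, z⟫)) _ z :=
    (((innerSL ℝ (c t)).hasFDerivAt (x := z)).const_mul β).exp
  have h2 : HasDerivAt (fun u : ℝ => Real.exp (β * ⟪c t, z + u • v⟫)) _ 0 := h1.hasLineDerivAt v
  have h3 : HasDerivAt (fun u : ℝ => expSum β c (z + u • v)) _ 0 := hasLineDerivAt_expSum β c z v
  have h4 := h2.mul (h3.rpow_const (p := p - 1)
    (Or.inl (by simpa using (expSum_pos β c z).ne')))
  unfold HasLineDerivAt expSumGrad
  convert! h4 using 1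
  simp [expSumHess, expSumGrad, innerSL_apply_apply]
  ring_nf

lemma continuous_expSumGrad (β p : ℝ) (c : T → E) (t : T) : Continuous (expSumGrad β p c t) := by
  have := continuous_expSum_rpow β c (p - 1)
  unfold expSumGrad; fun_prop

lemma continuous_expSumHess (β p : ℝ) (c : T → E) (t : T) (v : E) :
    Continuous (expSumHess β p c t v) := by
  have := continuous_expSum_rpow β c (p - 2)
  have := continuous_expSumGrad β p c t
  unfold expSumHess; fun_prop

lemma expSumGrad_pos (β p : ℝ) (c : T → E) (t : T) (z : E) : 0 < expSumGrad β p c t z :=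
  mul_pos (Real.exp_pos _) (Real.rpow_pos_of_pos (expSum_pos β c z) _)

lemma expSumGrad_le (β p : ℝ) (c : T → E) (t : T) (z : E) :
    expSumGrad β p c t z ≤ expSum β c z ^ p :=
  exp_mul_expSum_rpow_le β p c z t

lemma sum_expSumGrad (β p : ℝ) (c : T → E) (z : E) :
    ∑ t, expSumGrad β p c t z = expSum β c z ^ p := by
  simp only [expSumGrad]
  rw [← Finset.sum_mul, ← expSum, Real.rpow_sub_one (expSum_pos β c z).ne']
  have := (expSum_pos β c z).ne'
  field_simp

lemma exp_mul_exp_mul_expSum_rpow (β p : ℝ) (c : T → E) (s t : T) (z : E) :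
    Real.exp (β * ⟪c t, z⟫) * expSum β c z ^ (p - 2) * Real.exp (β * ⟪c s, z⟫) =
      expSumGrad β p c t z * (Real.exp (β * ⟪c s, z⟫) * (expSum β c z)⁻¹) := by
  have := (expSum_pos β c z).ne'
  rw [expSumGrad, show p - 2 = p - 1 - 1 by ring, Real.rpow_sub_one this]
  field_simp

/-- The second-order term is an average of ⟪c s, v⟫ under the Gibbs weights, which sum to one.
Bounds on single inner products therefore pass to the whole expression without a factor `card T`. -/
lemma expSumHess_eq (β p : ℝ) (c : T → E) (t : T) (v z : E) :
    expSumHess β p c t v z = β * expSumGrad β p c t z * (⟪c t, v⟫ +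
      (p - 1) * ∑ s, ⟪c s, v⟫ * (Real.exp (β * ⟪c s, z⟫) * (expSum β c z)⁻¹)) := by
  simp only [expSumHess, mul_add, Finset.mul_sum]
  congr 1
  · ring
  refine Finset.sum_congr rfl fun s _ => ?_
  have := exp_mul_exp_mul_expSum_rpow β p c s t z
  linear_combination (β * ⟪c s, v⟫ * (p - 1)) * this

lemma sum_softmax (β : ℝ) (c : T → E) (z : E) :
    ∑ s, Real.exp (β * ⟪c s, z⟫) * (expSum β c z)⁻¹ = 1 := by
  rw [← Finset.sum_mul, ← expSum, mul_inv_cancel₀ (expSum_pos β c z).ne']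

lemma abs_expSumHess_le {β p R : ℝ} (hβ : 0 ≤ β) (hp : 0 ≤ p) (hp1 : p ≤ 1) (c : T → E) (t : T)
    (v z : E) (hR : ∀ t, ‖c t‖ ≤ R) :
    |expSumHess β p c t v z| ≤ 2 * β * R * ‖v‖ * expSum β c z ^ p := by
  have hin : ∀ s, |⟪c s, v⟫| ≤ R * ‖v‖ := fun s =>
    (abs_real_inner_le_norm _ _).trans (by gcongr; exact hR s)
  have hR0 : 0 ≤ R := (norm_nonneg _).trans (hR t)
  have hS := expSum_pos β c z
  have hsum : |∑ s, ⟪c s, v⟫ * (Real.exp (β * ⟪c s, z⟫) * (expSum β c z)⁻¹)| ≤ R * ‖v‖ := by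
    calc _ ≤ ∑ s, R * ‖v‖ * (Real.exp (β * ⟪c s, z⟫) * (expSum β c z)⁻¹) := by
          refine (Finset.abs_sum_le_sum_abs _ _).trans (Finset.sum_le_sum fun s _ => ?_)
          rw [abs_mul, abs_of_nonneg (a := Real.exp _ * _) (by positivity)]
          gcongr
          exact hin s
      _ = _ := by rw [← Finset.mul_sum, sum_softmax, mul_one]
  rw [expSumHess_eq, abs_mul, abs_of_nonneg (a := β * _)
    (mul_nonneg hβ (expSumGrad_pos β p c t z).le)]
  calc _ ≤ β * expSum β c z ^ p * (R * ‖v‖ + 1 * (R * ‖v‖)) := by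
        gcongr
        · exact expSumGrad_le β p c t z
        · refine (abs_add_le _ _).trans (add_le_add (hin t) ?_)
          rw [abs_mul]
          gcongr
          rw [abs_le]; constructor <;> linarith
    _ = _ := by ring

end SoftMax

-- Slepian comparison by rotating one Gaussian family into the other.

section Interpolation

variable {E : Type*} [NormedAddCommGroup E] [InnerProductSpace ℝ E] [FiniteDimensional ℝ E]
  [MeasurableSpace E] [BorelSpace E] {T : Type*} [Fintype T] [Nonempty T]

lemma integrable_expSum_rpow {β p : ℝ} (hβ : 0 ≤ β) (hp : 0 ≤ p) (c : T → E) :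
    Integrable (fun z => expSum β c z ^ p) (stdGaussian E) := by
  obtain ⟨R, hR⟩ : ∃ R, ∀ t, ‖c t‖ ≤ R :=
    ⟨∑ t, ‖c t‖, fun t => Finset.single_le_sum (fun _ _ => norm_nonneg _) (Finset.mem_univ t)⟩
  refine ((integrable_exp_mul_norm_stdGaussian (p * β * R)).const_mul
    ((Fintype.card T : ℝ) ^ p)).mono' (continuous_expSum_rpow β c p).aestronglyMeasurable
    (Filter.Eventually.of_forall fun z => ?_)
  rw [Real.norm_of_nonneg (Real.rpow_nonneg (expSum_nonneg _ _ _) _)]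
  exact expSum_rpow_le_norm hβ hp z hR

lemma integrable_norm_mul_expSum_rpow {β p : ℝ} (hβ : 0 ≤ β) (hp : 0 ≤ p) (c : T → E) :
    Integrable (fun z => ‖z‖ * expSum β c z ^ p) (stdGaussian E) := by
  obtain ⟨R, hR⟩ : ∃ R, ∀ t, ‖c t‖ ≤ R :=
    ⟨∑ t, ‖c t‖, fun t => Finset.single_le_sum (fun _ _ => norm_nonneg _) (Finset.mem_univ t)⟩
  refine ((integrable_norm_mul_exp_mul_norm_stdGaussian (p * β * R)).const_mul
    ((Fintype.card T : ℝ) ^ p)).mono'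
    (continuous_norm.mul (continuous_expSum_rpow β c p)).aestronglyMeasurable
    (Filter.Eventually.of_forall fun z => ?_)
  rw [norm_mul, norm_norm, Real.norm_of_nonneg (Real.rpow_nonneg (expSum_nonneg _ _ _) _),
    mul_left_comm]
  gcongr
  exact expSum_rpow_le_norm hβ hp z hR

lemma integrable_expSumHess {β p : ℝ} (hβ : 0 ≤ β) (hp : 0 ≤ p) (hp1 : p ≤ 1) (c : T → E) (t : T)
    (v : E) : Integrable (expSumHess β p c t v) (stdGaussian E) := by
  obtain ⟨R, hR⟩ : ∃ R, ∀ t, ‖c t‖ ≤ R :=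
    ⟨∑ t, ‖c t‖, fun t => Finset.single_le_sum (fun _ _ => norm_nonneg _) (Finset.mem_univ t)⟩
  exact ((integrable_expSum_rpow hβ hp c).const_mul (2 * β * R * ‖v‖)).mono'
    (continuous_expSumHess β p c t v).aestronglyMeasurable
    (Filter.Eventually.of_forall fun z => abs_expSumHess_le hβ hp hp1 c t v z hR)

lemma integrable_inner_mul_expSumGrad {β p : ℝ} (hβ : 0 ≤ β) (hp : 0 ≤ p) (c : T → E) (t : T)
    (v : E) : Integrable (fun z => ⟪v, z⟫ * expSumGrad β p c t z) (stdGaussian E) := by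
  have := continuous_expSumGrad β p c t
  refine ((integrable_norm_mul_expSum_rpow hβ hp c).const_mul ‖v‖).mono'
    (by fun_prop) (Filter.Eventually.of_forall fun z => ?_)
  rw [norm_mul, Real.norm_of_nonneg (expSumGrad_pos β p c t z).le, ← mul_assoc]
  exact mul_le_mul (norm_inner_le_norm (𝕜 := ℝ) v z) (expSumGrad_le β p c t z)
    (expSumGrad_pos β p c t z).le (by positivity)

lemma integral_inner_mul_expSumGrad {β p : ℝ} (hβ : 0 ≤ β) (hp : 0 ≤ p) (hp1 : p ≤ 1) (c : T → E)
    (t : T) (v : E) :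
    ∫ z, ⟪v, z⟫ * expSumGrad β p c t z ∂(stdGaussian E) =
      ∫ z, expSumHess β p c t v z ∂(stdGaussian E) := by
  refine integral_inner_mul_stdGaussian (fun z => hasLineDerivAt_expSumGrad β p c t z v) ?_
    (integrable_expSumHess hβ hp hp1 c t v) (integrable_inner_mul_expSumGrad hβ hp c t v)
  refine (integrable_expSum_rpow hβ hp c).mono'
    (continuous_expSumGrad β p c t).aestronglyMeasurable (Filter.Eventually.of_forall fun z => ?_)
  rw [Real.norm_of_nonneg (expSumGrad_pos β p c t z).le]
  exact expSumGrad_le β p c t z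

/-- The rotation from the vectors `b` (angle `0`) to the vectors `a` (angle `π / 2`). -/
def rotated (a b : T → E) (φ : ℝ) (t : T) : E := Real.sin φ • a t + Real.cos φ • b t

omit [FiniteDimensional ℝ E] [MeasurableSpace E] [BorelSpace E] [Nonempty T] in
lemma norm_rotated_le (a b : T → E) (φ : ℝ) (t : T) :
    ‖rotated a b φ t‖ ≤ ∑ t, (‖a t‖ + ‖b t‖) := by
  refine le_trans ?_ (Finset.single_le_sum (f := fun t => ‖a t‖ + ‖b t‖)
    (fun _ _ => by positivity) (Finset.mem_univ t))
  refine (norm_add_le _ _).trans ?_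
  rw [norm_smul, norm_smul]
  gcongr
  · exact mul_le_of_le_one_left (norm_nonneg _) (Real.abs_sin_le_one φ)
  · exact mul_le_of_le_one_left (norm_nonneg _) (Real.abs_cos_le_one φ)

/-- The interpolated expectation. -/
def interp (β p : ℝ) (a b : T → E) (φ : ℝ) : ℝ :=
  ∫ z, expSum β (rotated a b φ) z ^ p ∂(stdGaussian E)

omit [FiniteDimensional ℝ E] [MeasurableSpace E] [BorelSpace E] [Nonempty T] [Fintype T] in
lemma hasDerivAt_inner_rotated (a b : T → E) (t : T) (z : E) (φ : ℝ) :
    HasDerivAt (fun φ => ⟪rotated a b φ t, z⟫) ⟪rotated a b (φ + Real.pi / 2) t, z⟫ φ := by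
  simp only [rotated, inner_add_left, real_inner_smul_left, Real.sin_add_pi_div_two,
    Real.cos_add_pi_div_two]
  exact ((Real.hasDerivAt_sin φ).mul_const _).add ((Real.hasDerivAt_cos φ).mul_const _)

omit [FiniteDimensional ℝ E] [MeasurableSpace E] [BorelSpace E] in
lemma hasDerivAt_expSum_rotated_rpow (β p : ℝ) (a b : T → E) (z : E) (φ : ℝ) :
    HasDerivAt (fun φ => expSum β (rotated a b φ) z ^ p)
      (p * β * ∑ t, ⟪rotated a b (φ + Real.pi / 2) t, z⟫ * expSumGrad β p (rotated a b φ) t z)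
      φ := by
  have h := (HasDerivAt.fun_sum (u := Finset.univ) fun t _ =>
    ((hasDerivAt_inner_rotated a b t z φ).const_mul β).exp).rpow_const (p := p)
    (Or.inl (expSum_pos β (rotated a b φ) z).ne')
  refine h.congr_deriv ?_
  simp only [expSumGrad, expSum, Finset.mul_sum, Finset.sum_mul]
  exact Finset.sum_congr rfl fun t _ => by ring

/-- Differentiation under the integral: the rotated vectors are bounded uniformly in the angle, so a
single dominating function ‖z‖ exp(C‖z‖) serves for all φ. -/
lemma hasDerivAt_interp {β p : ℝ} (hβ : 0 ≤ β) (hp : 0 ≤ p) (a b : T → E) (φ₀ : ℝ) :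
    HasDerivAt (interp β p a b)
      (∫ z, p * β * ∑ t, ⟪rotated a b (φ₀ + Real.pi / 2) t, z⟫ *
        expSumGrad β p (rotated a b φ₀) t z ∂(stdGaussian E)) φ₀ := by
  set R := ∑ t, (‖a t‖ + ‖b t‖)
  refine (hasDerivAt_integral_of_dominated_loc_of_deriv_le (s := Set.univ)
    (bound := fun z => p * β * R * (Fintype.card T : ℝ) ^ p * (‖z‖ * Real.exp (p * β * R * ‖z‖)))
    (F' := fun φ z => p * β * ∑ t, ⟪rotated a b (φ + Real.pi / 2) t, z⟫ *
        expSumGrad β p (rotated a b φ) t z) Filter.univ_mem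
    (Filter.Eventually.of_forall fun φ =>
      (continuous_expSum_rpow β (rotated a b φ) p).aestronglyMeasurable)
    (integrable_expSum_rpow hβ hp _) ?_ ?_
    ((integrable_norm_mul_exp_mul_norm_stdGaussian _).const_mul _)
    (Filter.Eventually.of_forall fun z φ _ => hasDerivAt_expSum_rotated_rpow β p a b z φ)).2
  · have := fun t => continuous_expSumGrad β p (rotated a b φ₀) t
    fun_prop
  · refine Filter.Eventually.of_forall fun z φ _ => ?_
    rw [norm_mul, Real.norm_of_nonneg (mul_nonneg hp hβ)]
    have h1 : ‖∑ t, ⟪rotated a b (φ + Real.pi / 2) t, z⟫ *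
        expSumGrad β p (rotated a b φ) t z‖ ≤ R * ‖z‖ * expSum β (rotated a b φ) z ^ p := by
      rw [← sum_expSumGrad, Finset.mul_sum]
      refine (norm_sum_le _ _).trans (Finset.sum_le_sum fun t _ => ?_)
      rw [norm_mul, Real.norm_of_nonneg (expSumGrad_pos β p _ t z).le]
      refine mul_le_mul_of_nonneg_right ?_ (expSumGrad_pos β p _ t z).le
      exact (norm_inner_le_norm (𝕜 := ℝ) _ _).trans (by gcongr; exact norm_rotated_le a b _ t)
    have hR : 0 ≤ R := Finset.sum_nonneg fun _ _ => by positivity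
    calc _ ≤ p * β * (R * ‖z‖ * ((Fintype.card T : ℝ) ^ p * Real.exp (p * β * R * ‖z‖))) := by
          gcongr
          refine h1.trans ?_
          gcongr
          exact expSum_rpow_le_norm hβ hp z (norm_rotated_le a b φ)
      _ = _ := by ring

omit [FiniteDimensional ℝ E] [MeasurableSpace E] [BorelSpace E] in
/-- The pointwise inequality behind Slepian's comparison. -/
lemma sum_expSumHess_le {β p : ℝ} (hβ : 0 ≤ β) (hp1 : p ≤ 1) {a b : T → E}
    (hab : ∀ s t, ⟪a s, b t⟫ = 0) (hdiag : ∀ t, ⟪a t, a t⟫ - ⟪b t, b t⟫ = -1)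
    (hoff : ∀ s t, -1 ≤ ⟪a s, a t⟫ - ⟪b s, b t⟫) {φ : ℝ} (hφ : 0 ≤ Real.sin φ * Real.cos φ)
    (z : E) :
    ∑ t, expSumHess β p (rotated a b φ) t (rotated a b (φ + Real.pi / 2) t) z ≤
      -(Real.sin φ * Real.cos φ) * (p * β) * expSum β (rotated a b φ) z ^ p := by
  have hin : ∀ s t, ⟪rotated a b φ s, rotated a b (φ + Real.pi / 2) t⟫ =
      Real.sin φ * Real.cos φ * (⟪a s, a t⟫ - ⟪b s, b t⟫) := by
    intro s t
    simp only [rotated, inner_add_left, inner_add_right, real_inner_smul_left,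
      real_inner_smul_right, Real.sin_add_pi_div_two, Real.cos_add_pi_div_two, hab,
      real_inner_comm (a t) (b s)]
    ring
  set c := rotated a b φ
  have key : ∀ t, expSumHess β p c t (rotated a b (φ + Real.pi / 2) t) z ≤
      -(Real.sin φ * Real.cos φ) * (p * β) * expSumGrad β p c t z := by
    intro t
    -- Gibbs average of the off-diagonal bound. As p - 1 ≤ 0, it turns into an upper bound, and
    -- together with the diagonal value it leaves -sin φ cos φ · p.
    have hsum : -(Real.sin φ * Real.cos φ) ≤ ∑ s, ⟪c s, rotated a b (φ + Real.pi / 2) t⟫ *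
        (Real.exp (β * ⟪c s, z⟫) * (expSum β c z)⁻¹) := by
      rw [← mul_one (-(Real.sin φ * Real.cos φ)), ← sum_softmax β c z, Finset.mul_sum]
      refine Finset.sum_le_sum fun s _ => ?_
      have := expSum_pos β c z
      gcongr
      rw [hin]
      nlinarith [hoff s t]
    rw [expSumHess_eq, hin, hdiag]
    have h2 : Real.sin φ * Real.cos φ * -1 + (p - 1) * ∑ s,
        ⟪c s, rotated a b (φ + Real.pi / 2) t⟫ * (Real.exp (β * ⟪c s, z⟫) * (expSum β c z)⁻¹) ≤
        -(Real.sin φ * Real.cos φ) * p := by nlinarith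
    have h3 := mul_le_mul_of_nonneg_left h2 (mul_nonneg hβ (expSumGrad_pos β p c t z).le)
    linarith
  refine (Finset.sum_le_sum fun t _ => key t).trans_eq ?_
  rw [← Finset.mul_sum, sum_expSumGrad]

/-- Stein's identity replaces each factor ⟪·, z⟫ in the derivative by a second derivative, to which
the pointwise inequality applies. The result is a Grönwall-type inequality. -/
lemma deriv_interp_le {β p : ℝ} (hβ : 0 ≤ β) (hp : 0 ≤ p) (hp1 : p ≤ 1) {a b : T → E}
    (hab : ∀ s t, ⟪a s, b t⟫ = 0) (hdiag : ∀ t, ⟪a t, a t⟫ - ⟪b t, b t⟫ = -1)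
    (hoff : ∀ s t, -1 ≤ ⟪a s, a t⟫ - ⟪b s, b t⟫) {φ : ℝ} (hφ : 0 ≤ Real.sin φ * Real.cos φ) :
    deriv (interp β p a b) φ ≤ -(Real.sin φ * Real.cos φ) * (p * β) ^ 2 * interp β p a b φ := by
  rw [(hasDerivAt_interp hβ hp a b φ).deriv, integral_const_mul, integral_finsetSum _
    fun t _ => integrable_inner_mul_expSumGrad hβ hp _ t _]
  simp only [integral_inner_mul_expSumGrad hβ hp hp1]
  rw [← integral_finsetSum _ fun t _ => integrable_expSumHess hβ hp hp1 _ t _]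
  calc _ ≤ p * β * ∫ z, -(Real.sin φ * Real.cos φ) * (p * β) *
        expSum β (rotated a b φ) z ^ p ∂(stdGaussian E) := by
        refine mul_le_mul_of_nonneg_left (integral_mono ?_ ?_ fun z =>
          sum_expSumHess_le hβ hp1 hab hdiag hoff hφ z) (mul_nonneg hp hβ)
        · exact integrable_finsetSum _ fun t _ => integrable_expSumHess hβ hp hp1 _ t _
        · exact (integrable_expSum_rpow hβ hp _).const_mul _
    _ = _ := by rw [integral_const_mul, interp]; ring

/-- Slepian's comparison for the soft maximum of two Gaussian families, where the second family
has variance larger by one. -/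
theorem exp_mul_integral_expSum_le {β p : ℝ} (hβ : 0 ≤ β) (hp : 0 ≤ p) (hp1 : p ≤ 1)
    {a b : T → E} (hab : ∀ s t, ⟪a s, b t⟫ = 0) (hdiag : ∀ t, ⟪a t, a t⟫ - ⟪b t, b t⟫ = -1)
    (hoff : ∀ s t, -1 ≤ ⟪a s, a t⟫ - ⟪b s, b t⟫) :
    Real.exp ((p * β) ^ 2 / 2) * ∫ z, expSum β a z ^ p ∂(stdGaussian E) ≤
      ∫ z, expSum β b z ^ p ∂(stdGaussian E) := by
  -- The exponential is the integrating factor of the differential inequality, since sin²/2 has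
  -- derivative sin · cos. It plays the role of the extra independent normal variable of variance
  -- one.
  have hd : ∀ φ, HasDerivAt (fun φ => Real.exp ((p * β) ^ 2 / 2 * Real.sin φ ^ 2) *
      interp β p a b φ) (Real.exp ((p * β) ^ 2 / 2 * Real.sin φ ^ 2) *
        ((p * β) ^ 2 / 2 * (2 * Real.sin φ * Real.cos φ)) * interp β p a b φ +
        Real.exp ((p * β) ^ 2 / 2 * Real.sin φ ^ 2) * deriv (interp β p a b) φ) φ := by
    intro φ
    have h1 := ((((Real.hasDerivAt_sin φ).pow 2).const_mul ((p * β) ^ 2 / 2)).exp).mul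
      (hasDerivAt_interp hβ hp a b φ).differentiableAt.hasDerivAt
    exact h1.congr_deriv (by simp)
  have hanti : AntitoneOn (fun φ => Real.exp ((p * β) ^ 2 / 2 * Real.sin φ ^ 2) *
      interp β p a b φ) (Set.Icc 0 (Real.pi / 2)) := by
    refine antitoneOn_of_deriv_nonpos (convex_Icc _ _)
      (fun φ _ => (hd φ).continuousAt.continuousWithinAt)
      (fun φ _ => (hd φ).differentiableAt.differentiableWithinAt) fun φ hφ => ?_
    rw [interior_Icc] at hφ
    have hs : 0 ≤ Real.sin φ :=
      Real.sin_nonneg_of_nonneg_of_le_pi hφ.1.le (by linarith [hφ.2, Real.pi_pos])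
    have hc : 0 ≤ Real.cos φ :=
      Real.cos_nonneg_of_neg_pi_div_two_le_of_le (by linarith [hφ.1, Real.pi_pos]) hφ.2.le
    have := mul_le_mul_of_nonneg_left
      (deriv_interp_le hβ hp hp1 hab hdiag hoff (mul_nonneg hs hc))
      (Real.exp_pos ((p * β) ^ 2 / 2 * Real.sin φ ^ 2)).le
    rw [(hd φ).deriv]
    linarith
  have h := hanti (Set.left_mem_Icc.2 (by positivity)) (Set.right_mem_Icc.2 (by positivity))
    (by positivity)
  have ha : rotated a b (Real.pi / 2) = a := by ext t; simp [rotated]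
  have hb : rotated a b 0 = b := by ext t; simp [rotated]
  simpa [interp, ha, hb] using h

end Interpolation

-- Exponential moments of Gaussian quadratic forms.

lemma gaussianPDFReal_mul_exp (θ x : ℝ) :
    gaussianPDFReal 0 1 x * Real.exp (θ / 2 * x ^ 2) =
      (√(2 * Real.pi))⁻¹ * Real.exp (-((1 - θ) / 2) * x ^ 2) := by
  rw [gaussianPDFReal, mul_assoc, ← Real.exp_add]
  simp
  ring_nf
  simp

lemma integral_exp_mul_sq_gaussianReal {θ : ℝ} (hθ : θ < 1) :
    ∫ x, Real.exp (θ / 2 * x ^ 2) ∂(gaussianReal 0 1) = (√(1 - θ))⁻¹ := by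
  rw [integral_gaussianReal_eq_integral_smul one_ne_zero]
  simp only [smul_eq_mul, gaussianPDFReal_mul_exp]
  rw [integral_const_mul, integral_gaussian, ← Real.sqrt_inv, ← Real.sqrt_inv,
    ← Real.sqrt_mul (by positivity)]
  congr 1
  have := Real.pi_pos
  have : 1 - θ ≠ 0 := by linarith
  field_simp

lemma integrable_exp_mul_sq_gaussianReal {θ : ℝ} (hθ : θ < 1) :
    Integrable (fun x => Real.exp (θ / 2 * x ^ 2)) (gaussianReal 0 1) := by
  rw [gaussianReal_of_var_ne_zero _ one_ne_zero, integrable_withDensity_iff_integrable_smul'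
    (measurable_gaussianPDF 0 1) (by simp [gaussianPDF])]
  simp only [toReal_gaussianPDF, smul_eq_mul, gaussianPDFReal_mul_exp]
  exact (integrable_exp_neg_mul_sq (by linarith)).const_mul _

section ExpQuadratic

variable {K : Type*} [Fintype K]

lemma integral_exp_sum_sq_stdGaussian {θ : K → ℝ} (hθ : ∀ k, θ k < 1) :
    ∫ z, Real.exp (∑ k, θ k / 2 * z k ^ 2) ∂(stdGaussian (EuclideanSpace ℝ K)) =
      ∏ k, (√(1 - θ k))⁻¹ := by
  rw [← map_pi_eq_stdGaussian, integral_map (by fun_prop) (by fun_prop)]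
  simp_rw [Real.exp_sum]
  rw [integral_fintype_prod_eq_prod (f := fun k x => Real.exp (θ k / 2 * x ^ 2))]
  simp [integral_exp_mul_sq_gaussianReal (hθ _)]

lemma integrable_exp_sum_sq_stdGaussian {θ : K → ℝ} (hθ : ∀ k, θ k < 1) :
    Integrable (fun z => Real.exp (∑ k, θ k / 2 * z k ^ 2))
      (stdGaussian (EuclideanSpace ℝ K)) := by
  rw [← map_pi_eq_stdGaussian, integrable_map_measure (by fun_prop) (by fun_prop)]
  simp_rw [Function.comp_def, Real.exp_sum]
  exact Integrable.fintype_prod (f := fun k x => Real.exp (θ k / 2 * x ^ 2))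
    fun k => integrable_exp_mul_sq_gaussianReal (hθ k)

end ExpQuadratic

-- Chevet's inequality and the norm of a Gaussian matrix.

section Chevet

variable {I : Type*} [Fintype I]

/-- Coordinates for a square Gaussian matrix and two auxiliary Gaussian vectors. -/
abbrev MatrixVectorSpace (I : Type*) := EuclideanSpace ℝ ((I × I) ⊕ (I ⊕ I))

/-- The coefficients of the bilinear form `⟪u, G v⟫`. -/
def tensorVec (t : EuclideanSpace ℝ I × EuclideanSpace ℝ I) : MatrixVectorSpace I :=
  WithLp.toLp 2 (Sum.elim (fun ij => t.1 ij.1 * t.2 ij.2) 0)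

/-- The coefficients of the linear form `⟪u, g⟫ + ⟪v, h⟫`. -/
def pairVec (t : EuclideanSpace ℝ I × EuclideanSpace ℝ I) : MatrixVectorSpace I :=
  WithLp.toLp 2 (Sum.elim 0 (Sum.elim t.1 t.2))

lemma inner_tensorVec_tensorVec (s t : EuclideanSpace ℝ I × EuclideanSpace ℝ I) :
    ⟪tensorVec s, tensorVec t⟫ = ⟪s.1, t.1⟫ * ⟪s.2, t.2⟫ := by
  simp only [tensorVec, PiLp.inner_apply, Fintype.sum_sum_type, Fintype.sum_prod_type,
    Finset.sum_mul_sum]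
  simp
  exact Finset.sum_congr rfl fun i _ => Finset.sum_congr rfl fun j _ => by ring

lemma inner_pairVec_pairVec (s t : EuclideanSpace ℝ I × EuclideanSpace ℝ I) :
    ⟪pairVec s, pairVec t⟫ = ⟪s.1, t.1⟫ + ⟪s.2, t.2⟫ := by
  simp [pairVec, PiLp.inner_apply]

lemma inner_tensorVec_pairVec (s t : EuclideanSpace ℝ I × EuclideanSpace ℝ I) :
    ⟪tensorVec s, pairVec t⟫ = 0 := by
  simp [pairVec, tensorVec, PiLp.inner_apply]

/-- Young's inequality coordinate by coordinate; the squared norm of `pairVec t` is 2, whence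
l²/(2θ) · 2. The bound does not depend on t, so it controls the maximum by a quadratic form whose
exponential moment is explicit. -/
lemma inner_pairVec_le {l θ : ℝ} (hθ : 0 < θ)
    (t : EuclideanSpace ℝ I × EuclideanSpace ℝ I) (h1 : ‖t.1‖ = 1) (h2 : ‖t.2‖ = 1)
    (z : MatrixVectorSpace I) :
    l * ⟪pairVec t, z⟫ ≤
      l ^ 2 / θ + ∑ k, Sum.elim (fun _ : I × I => 0) (fun _ : I ⊕ I => θ) k / 2 * z k ^ 2 := by
  have hnorm : ‖pairVec t‖ ^ 2 = 2 := by
    rw [← real_inner_self_eq_norm_sq, inner_pairVec_pairVec, real_inner_self_eq_norm_sq,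
      real_inner_self_eq_norm_sq, h1, h2]
    norm_num
  rw [EuclideanSpace.real_norm_sq_eq] at hnorm
  have h3 : l ^ 2 / θ = ∑ k, l ^ 2 / (2 * θ) * (pairVec t k) ^ 2 := by
    rw [← Finset.mul_sum, hnorm]
    field_simp
  rw [h3, ← Finset.sum_add_distrib, PiLp.inner_apply, Finset.mul_sum]
  refine Finset.sum_le_sum fun k _ => ?_
  have key : ∀ x y : ℝ, l * (x * y) ≤ l ^ 2 / (2 * θ) * x ^ 2 + θ / 2 * y ^ 2 := by
    intro x y
    have : l ^ 2 / (2 * θ) * x ^ 2 + θ / 2 * y ^ 2 - l * (x * y) =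
        (l * x - θ * y) ^ 2 / (2 * θ) := by
      field_simp; ring
    have : 0 ≤ (l * x - θ * y) ^ 2 / (2 * θ) := by positivity
    linarith
  rcases k with k | k
  · simp [pairVec]
  · simpa [mul_comm] using key (pairVec t (Sum.inr k)) (z (Sum.inr k))

variable [Nonempty I]

lemma integral_expSum_pairVec_le {T : Type*} [Fintype T] [Nonempty T]
    (t : T → EuclideanSpace ℝ I × EuclideanSpace ℝ I) (h1 : ∀ k, ‖(t k).1‖ = 1)
    (h2 : ∀ k, ‖(t k).2‖ = 1) {p β : ℝ} (hp : 0 < p) (hβ : 0 < β) :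
    ∫ z, expSum β (fun k => pairVec (t k)) z ^ p ∂(stdGaussian (MatrixVectorSpace I)) ≤
      (Fintype.card T : ℝ) ^ p *
        Real.exp ((p * β) ^ 2 + 2 * (p * β) * √(Fintype.card I)) := by
  set l := p * β with hl
  have hl0 : 0 < l := mul_pos hp hβ
  set r := √(Fintype.card I : ℝ) with hr
  have hr0 : 0 < r := Real.sqrt_pos.2 (by exact_mod_cast Fintype.card_pos)
  have hr2 : (Fintype.card I : ℝ) = r ^ 2 := (Real.sq_sqrt (by positivity)).symm
  -- With this choice l²/θ = l² + lr and (1 - θ)⁻¹ = 1 + l/r ≤ exp(l/r). The power r² = card I of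
  -- the latter contributes the second lr.
  set θ := l / (l + r) with hθ
  have hθ0 : 0 < θ := by positivity
  have hθ1 : θ < 1 := by rw [hθ, div_lt_one (by positivity)]; linarith
  set Θ : (I × I) ⊕ (I ⊕ I) → ℝ := Sum.elim (fun _ => 0) (fun _ => θ)
  have hΘ : ∀ k, Θ k < 1 := by rintro (k | k) <;> simp [Θ, hθ1]
  calc _ ≤ ∫ z : MatrixVectorSpace I, (Fintype.card T : ℝ) ^ p * Real.exp (l ^ 2 / θ) *
        Real.exp (∑ k, Θ k / 2 * z k ^ 2) ∂(stdGaussian (MatrixVectorSpace I)) := by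
        refine integral_mono (integrable_expSum_rpow hβ.le hp.le _)
          ((integrable_exp_sum_sq_stdGaussian hΘ).const_mul _) fun z => ?_
        refine (expSum_rpow_le (c := fun k => pairVec (t k)) (z := z) hp.le
          (M := (l ^ 2 / θ + ∑ k, Θ k / 2 * z k ^ 2) / p) fun k => ?_).trans_eq ?_
        · rw [le_div_iff₀ hp]
          have := inner_pairVec_le (l := l) hθ0 (t k) (h1 k) (h2 k) z
          rw [hl] at this ⊢
          linarith
        · rw [mul_div_cancel₀ _ hp.ne', Real.exp_add, mul_assoc]
    _ = (Fintype.card T : ℝ) ^ p * Real.exp (l ^ 2 / θ) * ((1 - θ)⁻¹) ^ Fintype.card I := by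
        rw [integral_const_mul, integral_exp_sum_sq_stdGaussian hΘ, Fintype.prod_sum_type]
        congr 1
        simp only [Θ, Sum.elim_inl, Sum.elim_inr, sub_zero, Real.sqrt_one, inv_one,
          Finset.prod_const_one, one_mul, Finset.prod_const, Finset.card_univ, Fintype.card_sum]
        -- The two auxiliary vectors have 2 card I coordinates, so the square roots pair up.
        rw [← two_mul, pow_mul, inv_pow, Real.sq_sqrt (sub_nonneg.2 hθ1.le)]
    _ ≤ (Fintype.card T : ℝ) ^ p * Real.exp (l ^ 2 / θ) *
          (Real.exp (l / r)) ^ Fintype.card I := by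
        gcongr
        have : (1 - θ)⁻¹ = l / r + 1 := by rw [hθ]; field_simp; simp [hr0.ne']
        rw [this]
        exact Real.add_one_le_exp _
    _ = _ := by
        rw [← Real.exp_nat_mul, mul_assoc, ← Real.exp_add, hr2, hθ]
        congr 2
        field_simp
        ring

/-- Markov's inequality for the smoothed exp(l max), then comparison with the decoupled process. The
comparison gains exp(-l²/2) against the exp(l²) of the decoupled bound. The final bound is free of
`card T`, so it survives an exhaustion by finite sets. -/
lemma measureReal_exists_lt_inner_tensorVec_le {T : Type*} [Fintype T] [Nonempty T]
    (t : T → EuclideanSpace ℝ I × EuclideanSpace ℝ I) (h1 : ∀ k, ‖(t k).1‖ = 1)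
    (h2 : ∀ k, ‖(t k).2‖ = 1) {l : ℝ} (hl : 0 < l) (s : ℝ) :
    (stdGaussian (MatrixVectorSpace I)).real {z | ∃ k, s < ⟪tensorVec (t k), z⟫} ≤
      Real.exp (-(l * s) + 2 * l * √(Fintype.card I) + l ^ 2 / 2) := by
  have key : ∀ p ∈ Set.Ioc (0 : ℝ) 1,
      (stdGaussian (MatrixVectorSpace I)).real {z | ∃ k, s < ⟪tensorVec (t k), z⟫} ≤
      (Fintype.card T : ℝ) ^ p *
        Real.exp (-(l * s) + 2 * l * √(Fintype.card I) + l ^ 2 / 2) := by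
    intro p hp
    have hβ : 0 < l / p := div_pos hl hp.1
    have hpl : p * (l / p) = l := mul_div_cancel₀ _ hp.1.ne'
    have hin : ∀ x : EuclideanSpace ℝ I, ‖x‖ = 1 → ⟪x, x⟫ = 1 := fun x hx => by
      rw [real_inner_self_eq_norm_sq, hx, one_pow]
    have hS := exp_mul_integral_expSum_le (p := p) (β := l / p) hβ.le hp.1.le hp.2
      (a := fun k => tensorVec (t k)) (b := fun k => pairVec (t k))
      (fun _ _ => inner_tensorVec_pairVec _ _)
      (fun k => by
        rw [inner_tensorVec_tensorVec, inner_pairVec_pairVec, hin _ (h1 k), hin _ (h2 k)]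
        norm_num)
      -- Amounts to (1 - ⟪u, u'⟫)(1 - ⟪v, v'⟫) ≥ 0 for unit vectors.
      (fun j k => by
        rw [inner_tensorVec_tensorVec, inner_pairVec_pairVec]
        have e1 := real_inner_le_norm (t j).1 (t k).1
        have e2 := real_inner_le_norm (t j).2 (t k).2
        rw [h1, h1] at e1
        rw [h2, h2] at e2
        nlinarith)
    have hM := mul_meas_ge_le_integral_of_nonneg (μ := stdGaussian (MatrixVectorSpace I))
      (f := fun z => expSum (l / p) (fun k => tensorVec (t k)) z ^ p)
      (Filter.Eventually.of_forall fun z => Real.rpow_nonneg (expSum_nonneg _ _ _) _)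
      (integrable_expSum_rpow hβ.le hp.1.le _) (Real.exp (l * s))
    have hsub : (stdGaussian (MatrixVectorSpace I)).real {z | ∃ k, s < ⟪tensorVec (t k), z⟫} ≤
        (stdGaussian (MatrixVectorSpace I)).real
          {z | Real.exp (l * s) ≤ expSum (l / p) (fun k => tensorVec (t k)) z ^ p} := by
      refine measureReal_mono ?_
      rintro z ⟨k, hk⟩
      calc Real.exp (l * s) ≤ Real.exp (l / p * ⟪tensorVec (t k), z⟫) ^ p := by
            rw [← Real.exp_mul, Real.exp_le_exp, mul_right_comm, div_mul_cancel₀ _ hp.1.ne']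
            gcongr
        _ ≤ _ := Real.rpow_le_rpow (Real.exp_pos _).le
            (exp_le_expSum (l / p) (fun k => tensorVec (t k)) z k) hp.1.le
    have hP := integral_expSum_pairVec_le t h1 h2 hp.1 hβ
    rw [hpl] at hS hP
    have h := (mul_le_mul_of_nonneg_left (hM.trans' (mul_le_mul_of_nonneg_left hsub
      (Real.exp_pos _).le)) (Real.exp_pos (l ^ 2 / 2)).le).trans (hS.trans hP)
    rw [← mul_assoc, ← Real.exp_add, ← le_div_iff₀' (Real.exp_pos _)] at h
    refine h.trans_eq ?_
    rw [mul_div_assoc, ← Real.exp_sub]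
    congr 2
    ring
  -- With l = pβ fixed, p → 0 is the zero-temperature limit: the prefactor tends to 1.
  have hlim : Filter.Tendsto (fun p : ℝ => (Fintype.card T : ℝ) ^ p *
      Real.exp (-(l * s) + 2 * l * √(Fintype.card I) + l ^ 2 / 2)) (nhdsWithin 0 (Set.Ioi 0))
      (nhds ((Fintype.card T : ℝ) ^ (0 : ℝ) *
        Real.exp (-(l * s) + 2 * l * √(Fintype.card I) + l ^ 2 / 2))) := by
    refine Filter.Tendsto.mul_const _ ?_
    exact (Real.continuousAt_const_rpow (by positivity)).tendsto.mono_left nhdsWithin_le_nhds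
  rw [Real.rpow_zero, one_mul] at hlim
  exact ge_of_tendsto hlim (Filter.mem_of_superset (Ioc_mem_nhdsGT one_pos) key)

variable [DecidableEq I]

/-- The Gaussian matrix in `MatrixVectorSpace I`. -/
def gaussMatrix (z : MatrixVectorSpace I) : Matrix I I ℝ := Matrix.of fun i j => z (Sum.inl (i, j))

omit [Nonempty I] in
lemma inner_tensorVec (t : EuclideanSpace ℝ I × EuclideanSpace ℝ I) (z : MatrixVectorSpace I) :
    ⟪tensorVec t, z⟫ = ⟪t.1, Matrix.toEuclideanCLM (𝕜 := ℝ) (gaussMatrix z) t.2⟫ := by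
  simp only [tensorVec, PiLp.inner_apply, Fintype.sum_sum_type, Fintype.sum_prod_type]
  simp [gaussMatrix, Matrix.ofLp_toEuclideanCLM, Matrix.mulVec, dotProduct, Finset.sum_mul]
  exact Finset.sum_congr rfl fun i _ => Finset.sum_congr rfl fun j _ => by ring

lemma norm_le_of_forall_inner_le {V : Type*} [NormedAddCommGroup V] [InnerProductSpace ℝ V]
    (A : V →L[ℝ] V) {s : ℝ} (hs : 0 ≤ s)
    (h : ∀ u v, ‖u‖ = 1 → ‖v‖ = 1 → ⟪u, A v⟫ ≤ s) : ‖A‖ ≤ s := by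
  refine A.opNorm_le_of_unit_norm hs fun v hv => ?_
  rcases eq_or_ne (A v) 0 with h0 | h0
  · rwa [h0, norm_zero]
  · have h1 := h (‖A v‖⁻¹ • A v) v (norm_smul_inv_norm (𝕜 := ℝ) h0) hv
    rw [real_inner_smul_left, real_inner_self_eq_norm_sq] at h1
    have : ‖A v‖ ≠ 0 := norm_ne_zero_iff.2 h0
    rwa [pow_two, inv_mul_cancel_left₀ this] at h1

/-- Sharp concentration of the operator norm of a square standard Gaussian matrix. -/
theorem stdGaussian_norm_gaussMatrix_gt_le {τ : ℝ} (hτ : 0 < τ) :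
    stdGaussian (MatrixVectorSpace I) {z | 2 * √(Fintype.card I) + τ <
      ‖Matrix.toEuclideanCLM (𝕜 := ℝ) (gaussMatrix z)‖} ≤
      ENNReal.ofReal (Real.exp (-τ ^ 2 / 2)) := by
  set s := 2 * √(Fintype.card I : ℝ) + τ with hs
  have hs0 : 0 ≤ s := by positivity
  have : Nonempty (Metric.sphere (0 : EuclideanSpace ℝ I) 1) :=
    (NormedSpace.sphere_nonempty.2 zero_le_one).to_subtype
  let t := TopologicalSpace.denseSeq
    (Metric.sphere (0 : EuclideanSpace ℝ I) 1 × Metric.sphere (0 : EuclideanSpace ℝ I) 1)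
  -- The supremum over the two spheres is exhausted by finite pieces of a dense sequence of pairs;
  -- `n + 1` keeps every piece nonempty.
  let A : ℕ → Set (MatrixVectorSpace I) := fun n =>
    {z | ∃ k : Fin (n + 1), s < ⟪tensorVec ((t k).1.1, (t k).2.1), z⟫}
  have hA : Monotone A := by
    rintro a b hab z ⟨k, hk⟩
    exact ⟨⟨k, by omega⟩, hk⟩
  have hsub : {z : MatrixVectorSpace I | s < ‖Matrix.toEuclideanCLM (𝕜 := ℝ) (gaussMatrix z)‖} ⊆ ⋃ n, A n := by
    intro z hz
    by_contra hcon
    refine (not_le.2 hz) (norm_le_of_forall_inner_le _ hs0 ?_)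
    have hall : ∀ n, ⟪((t n).1 : EuclideanSpace ℝ I),
        Matrix.toEuclideanCLM (𝕜 := ℝ) (gaussMatrix z) (t n).2⟫ ≤ s := by
      intro n
      by_contra h
      refine hcon (Set.mem_iUnion.2 ⟨n, ⟨n, by omega⟩, ?_⟩)
      rw [inner_tensorVec]
      exact not_le.1 h
    have hclosed : IsClosed {q : Metric.sphere (0 : EuclideanSpace ℝ I) 1 ×
        Metric.sphere (0 : EuclideanSpace ℝ I) 1 | ⟪(q.1 : EuclideanSpace ℝ I),
        Matrix.toEuclideanCLM (𝕜 := ℝ) (gaussMatrix z) q.2⟫ ≤ s} :=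
      isClosed_le (by fun_prop) continuous_const
    have huniv : ∀ q : Metric.sphere (0 : EuclideanSpace ℝ I) 1 ×
        Metric.sphere (0 : EuclideanSpace ℝ I) 1, ⟪(q.1 : EuclideanSpace ℝ I),
        Matrix.toEuclideanCLM (𝕜 := ℝ) (gaussMatrix z) q.2⟫ ≤ s := fun q =>
      (TopologicalSpace.denseRange_denseSeq _).induction_on q hclosed hall
    intro u v hu hv
    exact huniv (⟨u, mem_sphere_zero_iff_norm.2 hu⟩, ⟨v, mem_sphere_zero_iff_norm.2 hv⟩)
  refine (measure_mono hsub).trans ?_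
  rw [hA.measure_iUnion]
  refine iSup_le fun n => ?_
  rw [← ofReal_measureReal]
  -- The optimal exponent is l = τ: then -l(2r + τ) + 2lr + l²/2 = -τ²/2, where r = √(card I).
  refine ENNReal.ofReal_le_ofReal ((measureReal_exists_lt_inner_tensorVec_le
    (fun k : Fin (n + 1) => ((t k).1.1, (t k).2.1)) (fun k => by simp) (fun k => by simp)
    hτ s).trans_eq ?_)
  rw [hs]
  congr 1
  ring

end Chevet

-- Parseval's identity for Fourier integrals on L¹ ∩ L².

section Plancherel

open scoped FourierTransform

variable {V : Type*} [NormedAddCommGroup V] [InnerProductSpace ℝ V] [FiniteDimensional ℝ V]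
  [MeasurableSpace V] [BorelSpace V]

/-- On `L¹ ∩ L²` the `L²` Fourier transform is given by the Fourier integral. -/
lemma fourier_toLp_ae_eq {f : V → ℂ} (h1 : Integrable f) (h2 : MemLp f 2) :
    (𝓕 (h2.toLp f) : Lp ℂ 2 (volume : Measure V)) =ᵐ[volume] 𝓕 f := by
  have hcont : Continuous (𝓕 f) :=
    VectorFourier.fourierIntegral_continuous Real.continuous_fourierChar
      (by exact continuous_inner) h1
  refine ae_eq_of_integral_contDiff_smul_eq
    ((Lp.memLp _).locallyIntegrable (by norm_num)) hcont.locallyIntegrable ?_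
  intro g hg hgc
  have hgc' : HasCompactSupport (Complex.ofRealCLM ∘ g) := hgc.comp_left rfl
  have hg' : ContDiff ℝ (⊤ : ℕ∞) (Complex.ofRealCLM ∘ g) := by fun_prop
  set G := hgc'.toSchwartzMap hg' with hG
  have hGg : ∀ x, G x = (g x : ℂ) := fun x => rfl
  -- Both candidates are tested against smooth compactly supported g. The L² transform moves onto g
  -- as a tempered distribution, the Fourier integral by Fubini (`e3`).
  have e1 : ∫ x, g x • (𝓕 (h2.toLp f) : Lp ℂ 2 (volume : Measure V)) x =
      ∫ x, (𝓕 G) x • (h2.toLp f) x := by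
    have := Lp.toTemperedDistribution_apply (𝓕 (h2.toLp f)) G
    rw [← Lp.fourier_toTemperedDistribution_eq, TemperedDistribution.fourier_apply,
      Lp.toTemperedDistribution_apply] at this
    rw [this]
    simp [hGg]
  have e2 : ∫ x, (𝓕 G) x • (h2.toLp f) x = ∫ x, (𝓕 (G : V → ℂ)) x • f x := by
    refine integral_congr_ae ?_
    filter_upwards [h2.coeFn_toLp] with x hx
    rw [hx, SchwartzMap.fourier_coe]
  have e3 := VectorFourier.integral_fourierIntegral_smul_eq_flip (μ := volume) (ν := volume)
    (L := innerₗ V) (f := (G : V → ℂ)) (g := f) Real.continuous_fourierChar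
    (by exact continuous_inner) G.integrable h1
  rw [flip_innerₗ] at e3
  rw [e1, e2]
  refine e3.trans ?_
  simp only [hGg]
  rfl

lemma integrable_conj_fourier_mul_fourier {f g : V → ℂ} (hf1 : Integrable f) (hf2 : MemLp f 2)
    (hg1 : Integrable g) (hg2 : MemLp g 2) :
    Integrable (fun ξ => inner ℂ (𝓕 f ξ) (𝓕 g ξ)) := by
  refine (L2.integrable_inner (𝕜 := ℂ) (𝓕 (hf2.toLp f)) (𝓕 (hg2.toLp g))).congr ?_
  filter_upwards [fourier_toLp_ae_eq hf1 hf2, fourier_toLp_ae_eq hg1 hg2] with x hx hx'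
  rw [hx, hx']

/-- Parseval's identity on `L¹ ∩ L²`. -/
lemma integral_inner_fourier_fourier {f g : V → ℂ} (hf1 : Integrable f) (hf2 : MemLp f 2)
    (hg1 : Integrable g) (hg2 : MemLp g 2) :
    ∫ ξ, inner ℂ (𝓕 f ξ) (𝓕 g ξ) = ∫ y, inner ℂ (f y) (g y) := by
  have h := Lp.inner_fourier_eq (hf2.toLp f) (hg2.toLp g)
  rw [L2.inner_def, L2.inner_def] at h
  calc _ = _ := ?_
    _ = _ := h
    _ = _ := ?_
  · refine integral_congr_ae ?_
    filter_upwards [fourier_toLp_ae_eq hf1 hf2, fourier_toLp_ae_eq hg1 hg2] with x hx hx'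
    rw [hx, hx']
  · refine integral_congr_ae ?_
    filter_upwards [hf2.coeFn_toLp, hg2.coeFn_toLp] with x hx hx'
    rw [hx, hx']

end Plancherel

-- Ambiguity function of the vacuum.

section Vacuum

variable {m : ℕ}

lemma vacuumFun_neg (y : Config m) : vacuumFun m (-y) = vacuumFun m y := by simp [vacuumFun]

lemma conj_vacuumFun (y : Config m) : starRingEnd ℂ (vacuumFun m y) = vacuumFun m y :=
  Complex.conj_ofReal _

lemma continuous_vacuumFun : Continuous (vacuumFun m) := by
  unfold vacuumFun; fun_prop

lemma norm_vacuumFun_le (y : Config m) : ‖vacuumFun m y‖ ≤ Real.pi ^ (-(m : ℝ) / 4) := by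
  rw [vacuumFun, Complex.norm_real, Real.norm_of_nonneg (by positivity)]
  refine mul_le_of_le_one_right (by positivity) (Real.exp_le_one_iff.2 ?_)
  have := sq_nonneg ‖y‖
  linarith

lemma integrable_vacuumFun_mul (b : Config m) :
    Integrable fun u => vacuumFun m u * vacuumFun m (u - b) :=
  (memLp_vacuumFun m).integrable_mul
    ((memLp_vacuumFun m).comp_measurePreserving (measurePreserving_sub_right volume b))

/-- The ambiguity function of the vacuum. -/
lemma integral_exp_mul_vacuumFun_mul (a b : Config m) :
    ∫ u, Complex.exp (Complex.I * (⟪a, u⟫ : ℝ)) * (vacuumFun m u * vacuumFun m (u - b)) =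
      Complex.exp (Complex.I * (⟪a, b⟫ / 2 : ℝ)) *
        Complex.exp (-((‖a‖ ^ 2 + ‖b‖ ^ 2) / 4 : ℝ)) := by
  have h := GaussianFourier.integral_cexp_neg_mul_sq_norm_add (V := Config m) (b := 1)
    (by norm_num) Complex.I a
  -- Centring the two Gaussians at ∓b/2 lets the parallelogram law remove the cross term.
  rw [← integral_add_right_eq_self _ ((2 : ℝ)⁻¹ • b)]
  have hpt : ∀ u : Config m, Complex.exp (Complex.I * (⟪a, u + (2 : ℝ)⁻¹ • b⟫ : ℝ)) *
      (vacuumFun m (u + (2 : ℝ)⁻¹ • b) * vacuumFun m (u + (2 : ℝ)⁻¹ • b - b)) =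
      (((Real.pi ^ (-(m : ℝ) / 4)) ^ 2 : ℝ) : ℂ) * Complex.exp (Complex.I * (⟪a, b⟫ / 2 : ℝ)) *
      Complex.exp (-(‖b‖ ^ 2 / 4 : ℝ)) *
        Complex.exp (-1 * ‖u‖ ^ 2 + Complex.I * (⟪a, u⟫ : ℝ)) := by
    intro u
    have hb : u + (2 : ℝ)⁻¹ • b - b = u - (2 : ℝ)⁻¹ • b := by
      module
    have hpar : ‖u + (2 : ℝ)⁻¹ • b‖ ^ 2 + ‖u - (2 : ℝ)⁻¹ • b‖ ^ 2 =
        2 * ‖u‖ ^ 2 + ‖b‖ ^ 2 / 2 := by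
      have h1 := parallelogram_law_with_norm ℝ u ((2 : ℝ)⁻¹ • b)
      rw [norm_smul, Real.norm_of_nonneg (by norm_num)] at h1
      linear_combination h1
    have hvac : vacuumFun m (u + (2 : ℝ)⁻¹ • b) * vacuumFun m (u - (2 : ℝ)⁻¹ • b) =
        (((Real.pi ^ (-(m : ℝ) / 4)) ^ 2 : ℝ) : ℂ) *
          Complex.exp ((-‖u‖ ^ 2 - ‖b‖ ^ 2 / 4 : ℝ) : ℂ) := by
      rw [vacuumFun, vacuumFun, ← Complex.ofReal_mul, ← Complex.ofReal_exp, ← Complex.ofReal_mul]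
      congr 1
      rw [mul_mul_mul_comm, ← pow_two, ← Real.exp_add]
      congr 2
      linear_combination (-1 / 2) * hpar
    rw [hb, hvac, inner_add_right, real_inner_smul_right, mul_left_comm, ← Complex.exp_add,
      mul_assoc, mul_assoc, ← Complex.exp_add, ← Complex.exp_add]
    congr 2
    push_cast
    ring
  simp_rw [hpt]
  rw [integral_const_mul, h]
  have hπ : (Real.pi : ℂ) / 1 = ((Real.pi : ℝ) : ℂ) := by simp
  have hc : (((Real.pi ^ (-(m : ℝ) / 4)) ^ 2 : ℝ) : ℂ) *
      ((Real.pi : ℂ) / 1) ^ (Module.finrank ℝ (Config m) / 2 : ℂ) = 1 := by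
    have e : (Module.finrank ℝ (Config m) / 2 : ℂ) = ((m / 2 : ℝ) : ℂ) := by simp
    rw [hπ, e, ← Complex.ofReal_cpow Real.pi_pos.le, ← Complex.ofReal_mul,
      ← Real.rpow_natCast, ← Real.rpow_mul Real.pi_pos.le, ← Real.rpow_add Real.pi_pos,
      show -(m : ℝ) / 4 * (2 : ℕ) + m / 2 = 0 by push_cast; ring, Real.rpow_zero,
      Complex.ofReal_one]
  calc _ = ((((Real.pi ^ (-(m : ℝ) / 4)) ^ 2 : ℝ) : ℂ) *
      ((Real.pi : ℂ) / 1) ^ (Module.finrank ℝ (Config m) / 2 : ℂ)) *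
      (Complex.exp (Complex.I * (⟪a, b⟫ / 2 : ℝ)) * (Complex.exp (-(‖b‖ ^ 2 / 4 : ℝ)) *
        Complex.exp (Complex.I ^ 2 * ‖a‖ ^ 2 / (4 * 1)))) := by ring
    _ = _ := by
      rw [hc, one_mul, ← Complex.exp_add (-_), Complex.I_sq]
      congr 2
      push_cast
      ring

end Vacuum

-- Fourier transform of the Husimi function.

section HeterodyneDensity

open scoped FourierTransform

variable {m : ℕ}

lemma inner_eq_posPart_add_momPart (q k : Phase m) :
    ⟪q, k⟫ = ⟪posPart q, posPart k⟫ + ⟪momPart q, momPart k⟫ := by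
  simp [PiLp.inner_apply, posPart, momPart]

lemma norm_sq_eq_posPart_add_momPart (k : Phase m) :
    ‖k‖ ^ 2 = ‖posPart k‖ ^ 2 + ‖momPart k‖ ^ 2 := by
  simp only [← real_inner_self_eq_norm_sq, inner_eq_posPart_add_momPart]

lemma measurePreserving_posPart_momPart :
    MeasurePreserving (fun q : Phase m => (posPart q, momPart q)) volume
      (volume.prod volume) := by
  have h1 := PiLp.volume_preserving_ofLp (Fin m ⊕ Fin m)
  have h2 := volume_measurePreserving_sumPiEquivProdPi (fun _ : Fin m ⊕ Fin m => ℝ)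
  have h3 := (PiLp.volume_preserving_toLp (Fin m)).prod (PiLp.volume_preserving_toLp (Fin m))
  exact h3.comp (h2.comp h1)

lemma displace_ae_eq (ξ : Phase m) (ψ : Hilb m) :
    displace ξ ψ =ᵐ[volume] fun y => weylPhase ξ y * ψ (y - posPart ξ) :=
  (memLp_displace ξ ψ).coeFn_toLp

lemma comp_sub_ae_eq {f g : Config m → ℂ} (h : f =ᵐ[volume] g) (x : Config m) :
    (fun y => f (y - x)) =ᵐ[volume] fun y => g (y - x) :=
  (measurePreserving_sub_right volume x).quasiMeasurePreserving.ae_eq_comp h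

lemma coherent_ae_eq (ξ : Phase m) :
    coherent ξ =ᵐ[volume] fun y => weylPhase ξ y * vacuumFun m (y - posPart ξ) := by
  filter_upwards [displace_ae_eq ξ (vacuum m),
    comp_sub_ae_eq (memLp_vacuumFun m).coeFn_toLp (posPart ξ)] with y h1 h2
  rw [coherent, h1, vacuum, h2]

/-- The wave function `ψ` seen through the vacuum window centred at `x`. -/
def windowed (ψ : Hilb m) (x y : Config m) : ℂ := vacuumFun m (x - y) * ψ y

lemma memLp_windowed (ψ : Hilb m) (x : Config m) : MemLp (windowed ψ x) 2 volume := by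
  have hc : Continuous fun y => vacuumFun m (x - y) := continuous_vacuumFun.comp (by fun_prop)
  refine ((Lp.memLp ψ).const_mul ((Real.pi ^ (-(m : ℝ) / 4) : ℝ) : ℂ)).of_le
    (hc.aestronglyMeasurable.mul (Lp.aestronglyMeasurable ψ))
    (Filter.Eventually.of_forall fun y => ?_)
  rw [windowed, norm_mul, norm_mul, Complex.norm_real, Real.norm_of_nonneg (by positivity)]
  gcongr
  exact norm_vacuumFun_le _

lemma integrable_windowed (ψ : Hilb m) (x : Config m) : Integrable (windowed ψ x) := by
  have h : MemLp (fun y => vacuumFun m (x - y)) 2 (volume : Measure (Config m)) :=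
    (memLp_vacuumFun m).comp_measurePreserving (Measure.measurePreserving_sub_left volume x)
  exact h.integrable_mul (Lp.memLp ψ)

/-- Up to a phase, the heterodyne amplitude is a short-time Fourier transform with Gaussian window.
The factor (2π)⁻¹ adapts the momentum to the kernel exp(-2πi⟨y, ξ⟩). -/
lemma inner_coherent (q : Phase m) (ψ : Hilb m) :
    inner ℂ (coherent q) ψ = Complex.exp (Complex.I * (⟪momPart q, posPart q⟫ / 2 : ℝ)) *
      𝓕 (windowed ψ (posPart q)) ((2 * Real.pi)⁻¹ • momPart q) := by
  rw [L2.inner_def, Real.fourier_eq', ← integral_const_mul]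
  refine integral_congr_ae ?_
  filter_upwards [coherent_ae_eq q] with y hy
  rw [hy, windowed, ← vacuumFun_neg, neg_sub, RCLike.inner_apply, map_mul, conj_vacuumFun,
    weylPhase, ← Complex.exp_conj, smul_eq_mul, ← mul_assoc (Complex.exp _) (Complex.exp _),
    ← Complex.exp_add]
  have : starRingEnd ℂ (Complex.I * ((⟪momPart q, y⟫ - ⟪momPart q, posPart q⟫ / 2 : ℝ) : ℂ)) =
      Complex.I * (⟪momPart q, posPart q⟫ / 2 : ℝ) +
        ((-2 * Real.pi * ⟪y, (2 * Real.pi)⁻¹ • momPart q⟫ : ℝ) : ℂ) * Complex.I := by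
    rw [map_mul, Complex.conj_I, Complex.conj_ofReal, real_inner_smul_right,
      real_inner_comm (momPart q) y]
    have : (Real.pi : ℂ) ≠ 0 := by exact_mod_cast Real.pi_ne_zero
    push_cast
    field_simp
    ring
  rw [this]
  ring

/-- The unnormalised density of heterodyne detection. -/
def husimi (ψ : Hilb m) (z : Config m × Config m) : ℝ :=
  ‖𝓕 (windowed ψ z.1) ((2 * Real.pi)⁻¹ • z.2)‖ ^ 2

lemma norm_inner_coherent_sq (q : Phase m) (ψ : Hilb m) :
    ‖inner ℂ (coherent q) ψ‖ ^ 2 = husimi ψ (posPart q, momPart q) := by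
  rw [inner_coherent, norm_mul, mul_comm Complex.I, Complex.norm_exp_ofReal_mul_I, one_mul,
    husimi]

lemma stronglyMeasurable_husimi (ψ : Hilb m) : StronglyMeasurable (husimi ψ) := by
  have h : StronglyMeasurable fun z : (Config m × Config m) × Config m =>
      Complex.exp (((-2 * Real.pi * ⟪z.2, (2 * Real.pi)⁻¹ • z.1.2⟫ : ℝ) : ℂ) * Complex.I) •
        (vacuumFun m (z.1.1 - z.2) * ψ z.2) := by
    have h1 : Continuous fun z : (Config m × Config m) × Config m =>
      Complex.exp (((-2 * Real.pi * ⟪z.2, (2 * Real.pi)⁻¹ • z.1.2⟫ : ℝ) : ℂ) * Complex.I) := by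
      fun_prop
    have h2 : Continuous fun z : (Config m × Config m) × Config m =>
        vacuumFun m (z.1.1 - z.2) := continuous_vacuumFun.comp (by fun_prop)
    exact h1.stronglyMeasurable.smul (h2.stronglyMeasurable.mul
      ((Lp.stronglyMeasurable ψ).comp_measurable measurable_snd))
  have h' := (StronglyMeasurable.integral_prod_right' (ν := volume) h).norm.pow 2
  unfold husimi
  simp only [Real.fourier_eq', windowed]
  exact h'

/-- The autocorrelation `conj (ψ y) * ψ (y + b)`. -/
def autocorr (ψ : Hilb m) (b y : Config m) : ℂ := starRingEnd ℂ (ψ y) * ψ (y + b)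

lemma integrable_autocorr (ψ : Hilb m) (b : Config m) : Integrable (autocorr ψ b) :=
  (Lp.memLp ψ).star.integrable_mul
    ((Lp.memLp ψ).comp_measurePreserving (measurePreserving_add_right volume b))

lemma inner_windowed (ψ : Hilb m) (b x y : Config m) :
    inner ℂ (windowed ψ x y) (windowed ψ x (y + b)) =
      autocorr ψ b y * (vacuumFun m (x - y) * vacuumFun m (x - y - b)) := by
  rw [RCLike.inner_apply, windowed, windowed, map_mul, conj_vacuumFun, autocorr,
    ← sub_sub]
  ring

lemma integrable_autocorr_mul (ψ : Hilb m) (b : Config m) :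
    Integrable (fun z : Config m × Config m =>
      autocorr ψ b z.2 * (vacuumFun m (z.1 - z.2) * vacuumFun m (z.1 - z.2 - b)))
      (volume.prod volume) :=
  (integrable_autocorr ψ b).convolution_integrand (ContinuousLinearMap.mul ℂ ℂ)
    (integrable_vacuumFun_mul b)

lemma fourier_windowed_translate (ψ : Hilb m) (x b ξ : Config m) :
    𝓕 (fun y => windowed ψ x (y + b)) ξ =
      Complex.exp (Complex.I * (2 * Real.pi * ⟪b, ξ⟫ : ℝ)) * 𝓕 (windowed ψ x) ξ := by
  have h := congrFun (VectorFourier.fourierIntegral_comp_add_right Real.fourierChar volume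
    (innerₗ (Config m)) (windowed ψ x) b) ξ
  refine h.trans ?_
  rw [Circle.smul_def, Real.fourierChar_apply, smul_eq_mul, mul_comm _ Complex.I]
  rfl

/-- Modulation in p is translation by b in position, which puts the momentum integral into the form
required by Parseval. -/
lemma exp_mul_husimi (ψ : Hilb m) (x b p : Config m) :
    Complex.exp (Complex.I * (⟪b, p⟫ : ℝ)) * (husimi ψ (x, p) : ℂ) =
      inner ℂ (𝓕 (windowed ψ x) ((2 * Real.pi)⁻¹ • p))
        (𝓕 (fun y => windowed ψ x (y + b)) ((2 * Real.pi)⁻¹ • p)) := by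
  rw [fourier_windowed_translate, RCLike.inner_apply, husimi, real_inner_smul_right, mul_assoc]
  congr 1
  · congr 3
    have := Real.pi_ne_zero
    field_simp
  · rw [Complex.mul_conj, Complex.normSq_eq_norm_sq]

lemma integrable_exp_mul_husimi (ψ : Hilb m) (x b : Config m) :
    Integrable (fun p => Complex.exp (Complex.I * (⟪b, p⟫ : ℝ)) * (husimi ψ (x, p) : ℂ)) := by
  have h := integrable_conj_fourier_mul_fourier (integrable_windowed ψ x) (memLp_windowed ψ x)
    ((integrable_windowed ψ x).comp_add_right b)
    ((memLp_windowed ψ x).comp_measurePreserving (measurePreserving_add_right volume b))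
  simp_rw [exp_mul_husimi]
  exact (integrable_comp_smul_iff volume _ (by positivity)).2 h

lemma integral_exp_mul_husimi (ψ : Hilb m) (x b : Config m) :
    ∫ p, Complex.exp (Complex.I * (⟪b, p⟫ : ℝ)) * (husimi ψ (x, p) : ℂ) =
      (2 * Real.pi) ^ m * ∫ y, autocorr ψ b y *
        (vacuumFun m (x - y) * vacuumFun m (x - y - b)) := by
  have h := integral_inner_fourier_fourier (integrable_windowed ψ x) (memLp_windowed ψ x)
    ((integrable_windowed ψ x).comp_add_right b)
    ((memLp_windowed ψ x).comp_measurePreserving (measurePreserving_add_right volume b))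
  simp_rw [exp_mul_husimi]
  have h2 := Measure.integral_comp_smul (volume : Measure (Config m))
    (fun ξ => inner ℂ (𝓕 (windowed ψ x) ξ) (𝓕 (fun y => windowed ψ x (y + b)) ξ))
    (2 * Real.pi)⁻¹
  refine h2.trans ?_
  rw [h]
  simp only [inner_windowed]
  rw [finrank_euclideanSpace_fin, inv_pow, inv_inv, abs_of_nonneg (by positivity),
    Complex.real_smul]
  push_cast
  rfl

/-- Parseval at b = 0 evaluates each momentum fibre as a convolution of integrable functions, which
is integrable in x. -/
lemma integrable_husimi (ψ : Hilb m) : Integrable (husimi ψ) (volume.prod volume) := by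
  have h0 : ∀ z, ‖husimi ψ z‖ = husimi ψ z := fun z => Real.norm_of_nonneg (sq_nonneg _)
  have hx : ∀ x, Integrable (fun p => (husimi ψ (x, p) : ℂ)) := fun x => by
    simpa using integrable_exp_mul_husimi ψ x 0
  refine (integrable_prod_iff (stronglyMeasurable_husimi ψ).aestronglyMeasurable).2
    ⟨Filter.Eventually.of_forall fun x => ?_, ?_⟩
  · simpa using (hx x).re
  · simp only [h0]
    have h := (((integrable_autocorr_mul ψ 0).integral_prod_left).const_mul
      ((2 * Real.pi : ℂ) ^ m)).re
    refine h.congr (Filter.Eventually.of_forall fun x => ?_)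
    beta_reduce
    have := integral_exp_mul_husimi ψ x 0
    simp only [inner_zero_left, Complex.ofReal_zero, mul_zero, Complex.exp_zero, one_mul] at this
    rw [← this, integral_complex_ofReal]
    simp

/-- The Fourier transform of the heterodyne density in terms of the autocorrelation. -/
lemma integral_exp_mul_exp_mul_husimi (ψ : Hilb m) (a b : Config m) :
    ∫ z, Complex.exp (Complex.I * (⟪a, z.1⟫ : ℝ)) * (Complex.exp (Complex.I * (⟪b, z.2⟫ : ℝ)) *
        (husimi ψ z : ℂ)) ∂(volume.prod volume) =
      (2 * Real.pi) ^ m * (Complex.exp (-((‖a‖ ^ 2 + ‖b‖ ^ 2) / 4 : ℝ)) *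
        ∫ y, Complex.exp (Complex.I * (⟪a, y⟫ + ⟪a, b⟫ / 2 : ℝ)) * autocorr ψ b y) := by
  have hexp : ∀ c : ℝ, ‖Complex.exp (Complex.I * (c : ℂ))‖ = 1 := fun c => by
    rw [mul_comm, Complex.norm_exp_ofReal_mul_I]
  have hint : Integrable (fun z : Config m × Config m => Complex.exp (Complex.I * (⟪a, z.1⟫ : ℝ)) *
      (Complex.exp (Complex.I * (⟪b, z.2⟫ : ℝ)) * (husimi ψ z : ℂ))) (volume.prod volume) := by
    have hm := (stronglyMeasurable_husimi ψ).aestronglyMeasurable (μ := volume.prod volume)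
    refine (integrable_husimi ψ).mono ?_ (Filter.Eventually.of_forall fun z => ?_)
    · exact (Continuous.aestronglyMeasurable (by fun_prop)).mul
        ((Continuous.aestronglyMeasurable (by fun_prop)).mul
          (Complex.continuous_ofReal.comp_aestronglyMeasurable hm))
    · rw [norm_mul, norm_mul, hexp, hexp, one_mul, one_mul, Complex.norm_real]
  have hint2 : Integrable (fun z : Config m × Config m => Complex.exp (Complex.I * (⟪a, z.1⟫ : ℝ)) *
      (autocorr ψ b z.2 * (vacuumFun m (z.1 - z.2) * vacuumFun m (z.1 - z.2 - b))))
      (volume.prod volume) := by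
    refine (integrable_autocorr_mul ψ b).mono ?_ (Filter.Eventually.of_forall fun z => ?_)
    · exact (Continuous.aestronglyMeasurable (by fun_prop)).mul
        (integrable_autocorr_mul ψ b).aestronglyMeasurable
    · rw [norm_mul, hexp, one_mul]
  rw [integral_prod _ hint]
  calc _ = ∫ x, (2 * Real.pi : ℂ) ^ m * ∫ y, Complex.exp (Complex.I * (⟪a, x⟫ : ℝ)) *
        (autocorr ψ b y * (vacuumFun m (x - y) * vacuumFun m (x - y - b))) := by
        congr 1; ext x
        dsimp only
        rw [integral_const_mul, integral_exp_mul_husimi, integral_const_mul]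
        ring
    _ = (2 * Real.pi : ℂ) ^ m * ∫ y, ∫ x, Complex.exp (Complex.I * (⟪a, x⟫ : ℝ)) *
        (autocorr ψ b y * (vacuumFun m (x - y) * vacuumFun m (x - y - b))) := by
        rw [integral_const_mul, integral_integral_swap hint2]
    _ = _ := by
        congr 1
        rw [← integral_const_mul]
        congr 1; ext y
        -- Shifting x by y separates the variables: the inner integral becomes the vacuum ambiguity
        -- function.
        rw [← integral_add_right_eq_self _ y]
        have := integral_exp_mul_vacuumFun_mul a b
        calc _ = ∫ u, (Complex.exp (Complex.I * (⟪a, y⟫ : ℝ)) * autocorr ψ b y) *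
            (Complex.exp (Complex.I * (⟪a, u⟫ : ℝ)) * (vacuumFun m u * vacuumFun m (u - b))) := by
              congr 1; ext u
              rw [add_sub_cancel_right, inner_add_right, Complex.ofReal_add, mul_add,
                Complex.exp_add]
              ring
          _ = _ := by
              rw [integral_const_mul, this, Complex.ofReal_add, mul_add, Complex.exp_add]
              ring

end HeterodyneDensity

-- Weyl relations and the Gaussian law of heterodyne samples.

section HeterodyneLaw

variable {m : ℕ}

lemma act_mul (A B : PMatrix m) (ξ : Phase m) : act (A * B) ξ = act A (act B ξ) := by
  simp [act]

lemma act_apply (A : PMatrix m) (ξ : Phase m) (i : Fin m ⊕ Fin m) :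
    act A ξ i = ∑ j, A i j * ξ j := by
  simp [act, Matrix.ofLp_toEuclideanCLM, Matrix.mulVec, dotProduct]

lemma posPart_act_J (k : Phase m) : posPart (act (Matrix.J (Fin m) ℝ) k) = -momPart k := by
  ext j
  simp [posPart, momPart, act_apply, Matrix.J, Matrix.one_apply]

lemma momPart_act_J (k : Phase m) : momPart (act (Matrix.J (Fin m) ℝ) k) = posPart k := by
  ext j
  simp [posPart, momPart, act_apply, Matrix.J, Matrix.one_apply]

lemma inner_displace_displace (r : Phase m) (φ χ : Hilb m) :
    inner ℂ (displace r φ) (displace r χ) = inner ℂ φ χ := by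
  rw [L2.inner_def, L2.inner_def,
    ← integral_sub_right_eq_self (fun y => inner ℂ (φ y) (χ y)) (posPart r)]
  refine integral_congr_ae ?_
  filter_upwards [displace_ae_eq r φ, displace_ae_eq r χ] with y h1 h2
  rw [h1, h2, RCLike.inner_apply, RCLike.inner_apply, map_mul]
  have : weylPhase r y * starRingEnd ℂ (weylPhase r y) = 1 := by
    rw [Complex.mul_conj, Complex.normSq_eq_norm_sq, norm_weylPhase]
    simp
  linear_combination (χ (y - posPart r) * starRingEnd ℂ (φ (y - posPart r))) * this

/-- The Weyl commutation relation. -/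
lemma displace_displace_comm (k r : Phase m) (φ : Hilb m) :
    displace (act (Matrix.J (Fin m) ℝ) k) (displace r φ) =
      Complex.exp (Complex.I * (⟪k, r⟫ : ℝ)) •
        displace r (displace (act (Matrix.J (Fin m) ℝ) k) φ) := by
  set κ := act (Matrix.J (Fin m) ℝ) k with hκ
  refine Lp.ext ?_
  filter_upwards [displace_ae_eq κ (displace r φ), comp_sub_ae_eq (displace_ae_eq r φ) (posPart κ),
    Lp.coeFn_smul (Complex.exp (Complex.I * (⟪k, r⟫ : ℝ))) (displace r (displace κ φ)),
    displace_ae_eq r (displace κ φ), comp_sub_ae_eq (displace_ae_eq κ φ) (posPart r)]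
    with y h1 h2 h3 h4 h5
  rw [h1, h2, h3, Pi.smul_apply, h4, h5, smul_eq_mul, sub_right_comm, ← mul_assoc, ← mul_assoc,
    ← mul_assoc]
  congr 1
  simp only [weylPhase, ← Complex.exp_add]
  congr 1
  rw [← mul_add, ← mul_add, ← mul_add, ← Complex.ofReal_add, ← Complex.ofReal_add,
    ← Complex.ofReal_add]
  congr 2
  simp only [inner_eq_posPart_add_momPart k r, hκ, posPart_act_J, momPart_act_J, inner_sub_right,
    inner_neg_right, real_inner_comm (momPart k) (momPart r)]
  ring

lemma inner_displace_act_J (k : Phase m) (ψ : Hilb m) :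
    inner ℂ ψ (displace (act (Matrix.J (Fin m) ℝ) k) ψ) =
      ∫ y, Complex.exp (Complex.I * (⟪posPart k, y⟫ + ⟪posPart k, momPart k⟫ / 2 : ℝ)) *
        autocorr ψ (momPart k) y := by
  rw [L2.inner_def]
  refine integral_congr_ae ?_
  filter_upwards [displace_ae_eq (act (Matrix.J (Fin m) ℝ) k) ψ] with y hy
  rw [hy, weylPhase, posPart_act_J, momPart_act_J, RCLike.inner_apply, autocorr, sub_neg_eq_add,
    inner_neg_right, neg_div, sub_neg_eq_add]
  ring

lemma inner_vacuum_displace_act_J (k : Phase m) :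
    inner ℂ (vacuum m) (displace (act (Matrix.J (Fin m) ℝ) k) (vacuum m)) =
      Complex.exp (-(‖k‖ ^ 2 / 4 : ℝ)) := by
  rw [inner_displace_act_J]
  have h := integral_exp_mul_vacuumFun_mul (posPart k) (-momPart k)
  have hvac : vacuum m =ᵐ[volume] vacuumFun m := (memLp_vacuumFun m).coeFn_toLp
  calc _ = ∫ y, Complex.exp (Complex.I * (⟪posPart k, momPart k⟫ / 2 : ℝ)) *
        (Complex.exp (Complex.I * (⟪posPart k, y⟫ : ℝ)) *
          (vacuumFun m y * vacuumFun m (y - -momPart k))) := by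
        refine integral_congr_ae ?_
        filter_upwards [hvac, comp_sub_ae_eq hvac (-momPart k)] with y h1 h2
        rw [sub_neg_eq_add] at h2
        rw [autocorr, h1, sub_neg_eq_add, h2, conj_vacuumFun, Complex.ofReal_add, mul_add,
          Complex.exp_add]
        ring
    _ = _ := by
        rw [integral_const_mul, h, ← mul_assoc, ← Complex.exp_add, inner_neg_right, norm_neg,
          norm_sq_eq_posPart_add_momPart]
        simp [neg_div]

lemma measurable_heterodyne_density (ψ : Hilb m) :
    Measurable fun q : Phase m => ‖inner ℂ (coherent q) ψ‖ ^ 2 / (2 * Real.pi) ^ m := by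
  simp only [norm_inner_coherent_sq]
  exact ((stronglyMeasurable_husimi ψ).measurable.comp
    measurePreserving_posPart_momPart.measurable).div_const _

/-- Finiteness suffices for uniqueness of characteristic functions; normalisation then follows from
the identification with a Gaussian law. -/
lemma isFiniteMeasure_heterodyneLaw (ψ : Hilb m) : IsFiniteMeasure (heterodyneLaw ψ) := by
  refine isFiniteMeasure_withDensity_ofReal ?_
  simp only [norm_inner_coherent_sq]
  exact ((measurePreserving_posPart_momPart.integrable_comp
    (stronglyMeasurable_husimi ψ).aestronglyMeasurable).2 (integrable_husimi ψ)).div_const _ |>.2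

/-- D_{Jk} is exp(i kᵀR̂), so the second factor is the quantum characteristic function of ψ. The
first is the vacuum noise added by the measurement, the source of the identity matrix in `noiseCov`.
-/
lemma charFun_heterodyneLaw (ψ : Hilb m) (k : Phase m) :
    charFun (heterodyneLaw ψ) k = Complex.exp (-(‖k‖ ^ 2 / 4 : ℝ)) *
      inner ℂ ψ (displace (act (Matrix.J (Fin m) ℝ) k) ψ) := by
  have hmeas : AEStronglyMeasurable (fun z : Config m × Config m =>
      Complex.exp (Complex.I * (⟪posPart k, z.1⟫ : ℝ)) *
        (Complex.exp (Complex.I * (⟪momPart k, z.2⟫ : ℝ)) * (husimi ψ z : ℂ)))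
      (volume.prod volume) :=
    (Continuous.aestronglyMeasurable (by fun_prop)).mul
        ((Continuous.aestronglyMeasurable (by fun_prop)).mul
          (Complex.continuous_ofReal.comp_aestronglyMeasurable
            (stronglyMeasurable_husimi ψ).aestronglyMeasurable))
  have h := integral_exp_mul_exp_mul_husimi ψ (posPart k) (momPart k)
  rw [← measurePreserving_posPart_momPart.map_eq] at h hmeas
  rw [integral_map measurePreserving_posPart_momPart.measurable.aemeasurable hmeas] at h
  rw [charFun_apply, heterodyneLaw, integral_withDensity_eq_integral_toReal_smul
    (measurable_heterodyne_density ψ).ennreal_ofReal (by simp), inner_displace_act_J,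
    norm_sq_eq_posPart_add_momPart]
  have hπ : ((2 * Real.pi : ℂ) ^ m) ≠ 0 :=
    pow_ne_zero _ (mul_ne_zero two_ne_zero (by exact_mod_cast Real.pi_ne_zero))
  rw [← mul_right_inj' hπ, ← h, ← integral_const_mul]
  congr 1; ext q
  rw [ENNReal.toReal_ofReal (by positivity), norm_inner_coherent_sq, Complex.real_smul,
    inner_eq_posPart_add_momPart, real_inner_comm, real_inner_comm (momPart k),
    Complex.ofReal_add, add_mul, Complex.exp_add]
  push_cast
  field_simp

lemma quadForm_noiseCov (S : PMatrix m) (k : Phase m) :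
    k.ofLp ⬝ᵥ (noiseCov S).mulVec k.ofLp = (‖act S.transpose k‖ ^ 2 + ‖k‖ ^ 2) / 2 := by
  have h1 : ‖act S.transpose k‖ ^ 2 = k.ofLp ⬝ᵥ (S * S.transpose).mulVec k.ofLp := by
    rw [EuclideanSpace.real_norm_sq_eq, ← Matrix.mulVec_mulVec, Matrix.dotProduct_mulVec,
      ← Matrix.mulVec_transpose]
    simp [act, Matrix.ofLp_toEuclideanCLM, dotProduct, pow_two]
  have h2 : ‖k‖ ^ 2 = k.ofLp ⬝ᵥ k.ofLp := by
    rw [EuclideanSpace.real_norm_sq_eq]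
    simp [dotProduct, pow_two]
  rw [h1, h2, noiseCov, Matrix.smul_mulVec, Matrix.add_mulVec, Matrix.one_mulVec,
    dotProduct_smul, dotProduct_add, smul_eq_mul]
  ring

lemma posSemidef_noiseCov (S : PMatrix m) : (noiseCov S).PosSemidef := by
  refine Matrix.PosSemidef.smul (Matrix.PosSemidef.add ?_ Matrix.PosSemidef.one) (by norm_num)
  simpa using Matrix.posSemidef_self_mul_conjTranspose S

/-- The heterodyne statistics of a Gaussian unitary applied to a coherent state. -/
theorem heterodyneLaw_gaussianUnitary {r : Phase m} {S : PMatrix m}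
    (hS : S ∈ Matrix.symplecticGroup (Fin m) ℝ) {G : Hilb m ≃ₗᵢ[ℂ] Hilb m}
    (hG : IsGaussianUnitary r S G) (ξ : Phase m) :
    heterodyneLaw (G (coherent ξ)) = multivariateGaussian (r + act S ξ) (noiseCov S) := by
  obtain ⟨U, hU, hGU⟩ := hG
  have := isFiniteMeasure_heterodyneLaw (G (coherent ξ))
  refine Measure.ext_of_charFun (funext fun k => ?_)
  have hψ : G (coherent ξ) = displace r (displace (act S ξ) (U (vacuum m))) := by
    rw [hGU, coherent, hU]
  -- From S J Sᵀ = J: in this form the Weyl operator can be pulled back through U, giving a vacuum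
  -- expectation at Sᵀk.
  have hJ : act (Matrix.J (Fin m) ℝ) k =
      act S (act (Matrix.J (Fin m) ℝ) (act S.transpose k)) := by
    rw [← act_mul, ← act_mul, SymplecticGroup.mem_iff.1 hS]
  have hconj : ∀ (s : Phase m) (φ : Hilb m),
      inner ℂ (displace s φ) (displace (act (Matrix.J (Fin m) ℝ) k) (displace s φ)) =
      Complex.exp (Complex.I * (⟪k, s⟫ : ℝ)) *
        inner ℂ φ (displace (act (Matrix.J (Fin m) ℝ) k) φ) := fun s φ => by
    rw [displace_displace_comm, inner_smul_right, inner_displace_displace]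
  rw [charFun_heterodyneLaw, hψ, hconj, hconj, hJ, ← hU, LinearIsometryEquiv.inner_map_map,
    inner_vacuum_displace_act_J, charFun_multivariateGaussian (posSemidef_noiseCov S),
    ← Complex.exp_add, ← Complex.exp_add, ← Complex.exp_add]
  congr 1
  rw [quadForm_noiseCov, inner_add_right]
  push_cast
  ring

lemma act_single (S : PMatrix m) (i : Fin m ⊕ Fin m) (c : ℝ) :
    act S (EuclideanSpace.single i c) = c • column S i := by
  ext a
  simp [act_apply, column, mul_comm]

end HeterodyneLaw

-- Independence of block sums.

section IndependentSums

variable {Ω : Type*} [MeasurableSpace Ω] {P : Measure Ω} {ι κ : Type*} [Fintype ι] [Fintype κ]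
  {E : Type*} [NormedAddCommGroup E] [InnerProductSpace ℝ E] [MeasurableSpace E] [BorelSpace E]
  [SecondCountableTopology E] [CompleteSpace E]

/-- Sums over disjoint blocks of an independent family are independent. -/
lemma iIndepFun_sum_of_iIndepFun {Z : ι × κ → Ω → E} (hZ : ∀ s, AEMeasurable (Z s) P)
    (h : iIndepFun Z P) : iIndepFun (fun i ω => ∑ k, Z (i, k) ω) P := by
  have hP := h.isProbabilityMeasure
  refine (iIndepFun_iff_charFun_pi fun i => by fun_prop).2 fun t => ?_
  -- A test vector constant on each block sees only the block sums.
  have hj := (iIndepFun_iff_charFun_pi hZ).1 h (WithLp.toLp 2 fun s => t s.1)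
  have hblock : ∀ i, charFun (P.map fun ω => ∑ k, Z (i, k) ω) (t i) =
      ∏ k, charFun (P.map (Z (i, k))) (t i) := fun i => by
    rw [(h.precomp (g := fun k => (i, k)) (Prod.mk_right_injective i)).charFun_map_fun_sum_eq_prod
      fun k => hZ (i, k), Finset.prod_apply]
  simp only [hblock]
  rw [Fintype.prod_prod_type] at hj
  rw [← hj, charFun_apply, charFun_apply, integral_map (by fun_prop) (by fun_prop),
    integral_map (by fun_prop) (by fun_prop)]
  congr 1; ext ω
  simp only [PiLp.inner_apply, Fintype.sum_prod_type, sum_inner]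

end IndependentSums

-- Law and independence of the column errors.

section ColumnErrors

variable {m N : ℕ} {Ω : Type*} [MeasurableSpace Ω] {P : Measure Ω}

/-- The contribution of a single shot to the error of a column estimator. -/
def shotError (η : ℝ) (r : Phase m) (S : PMatrix m) (Y : SymShot m N → Ω → Phase m)
    (s : SymShot m N) (ω : Ω) : Phase m :=
  (((s.2.1 : ℤ) : ℝ) * (2 * η * N)⁻¹) • (Y s ω - (r + (((s.2.1 : ℤ) : ℝ) * η) • column S s.1))

omit [MeasurableSpace Ω] in
-- The signs make the contributions of r cancel, while each of the 2N shots carries S_i/(2N) in its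
-- mean.
lemma columnEstimator_sub_column_eq_sum (hN : 0 < N) {η : ℝ} (hη : 0 < η) (r : Phase m)
    (S : PMatrix m) (Y : SymShot m N → Ω → Phase m) (i : Fin m ⊕ Fin m) (ω : Ω) :
    columnEstimator η Y i ω - column S i = ∑ k : ℤˣ × Fin N, shotError η r S Y (i, k) ω := by
  have hN' : (N : ℝ) ≠ 0 := by positivity
  rw [Fintype.sum_prod_type]
  have hu : (Finset.univ : Finset ℤˣ) = {1, -1} := rfl
  rw [hu, Finset.sum_pair (by decide)]
  simp only [shotError, columnEstimator, batchMean, smul_sub, Finset.sum_sub_distrib,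
    ← Finset.smul_sum, Finset.sum_const, Finset.card_univ, Fintype.card_fin]
  ext a
  simp
  field_simp
  ring

lemma charFun_shotError {η : ℝ} {r : Phase m} {S : PMatrix m}
    {Y : SymShot m N → Ω → Phase m} {s : SymShot m N}
    (hY : HasLaw (Y s) (multivariateGaussian (r + (((s.2.1 : ℤ) : ℝ) * η) • column S s.1)
      (noiseCov S)) P) (t : Phase m) :
    charFun (P.map (shotError η r S Y s)) t =
      Complex.exp (-((2 * η * N)⁻¹ ^ 2 *
        (t.ofLp ⬝ᵥ (noiseCov S).mulVec t.ofLp) / 2 : ℝ)) := by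
  set μ := r + (((s.2.1 : ℤ) : ℝ) * η) • column S s.1
  have hm := hY.aemeasurable
  unfold shotError
  rw [charFun_map_smul_comp (by fun_prop)]
  simp only [sub_eq_add_neg]
  have : (fun ω => Y s ω + -μ) = (fun y => y + -μ) ∘ Y s := rfl
  rw [this, ← AEMeasurable.map_map_of_aemeasurable (by fun_prop) hm, charFun_map_add_const,
    hY.map_eq, charFun_multivariateGaussian (posSemidef_noiseCov S), ← Complex.exp_add]
  have hsq : (((s.2.1 : ℤ) : ℝ)) ^ 2 = 1 := by
    rcases Int.units_eq_one_or s.2.1 with h | h <;> simp [h]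
  have hq : ∀ c : ℝ, (c • t).ofLp ⬝ᵥ (noiseCov S).mulVec (c • t).ofLp =
      c ^ 2 * (t.ofLp ⬝ᵥ (noiseCov S).mulVec t.ofLp) := fun c => by
    rw [WithLp.ofLp_smul, Matrix.mulVec_smul, dotProduct_smul, smul_dotProduct]
    simp only [smul_eq_mul]; ring
  congr 1
  rw [hq, mul_pow, hsq, inner_neg_left, real_inner_comm μ]
  push_cast
  ring

lemma hasLaw_columnEstimator_sub_column (hN : 0 < N) {η : ℝ} (hη : 0 < η) {r : Phase m}
    {S : PMatrix m} {Y : SymShot m N → Ω → Phase m} (hind : iIndepFun Y P)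
    (hY : ∀ s, HasLaw (Y s) (multivariateGaussian (r + (((s.2.1 : ℤ) : ℝ) * η) • column S s.1)
      (noiseCov S)) P) (i : Fin m ⊕ Fin m) :
    HasLaw (fun ω => columnEstimator η Y i ω - column S i)
      (multivariateGaussian 0 ((2 * η ^ 2 * (N : ℝ))⁻¹ • noiseCov S)) P := by
  have hP := hind.isProbabilityMeasure
  have hZ : ∀ s, AEMeasurable (shotError η r S Y s) P := fun s => by
    have := (hY s).aemeasurable
    unfold shotError; fun_prop
  have hind' : iIndepFun (shotError η r S Y) P :=
    hind.comp₀ (fun s y => (((s.2.1 : ℤ) : ℝ) * (2 * η * N)⁻¹) •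
      (y - (r + (((s.2.1 : ℤ) : ℝ) * η) • column S s.1))) (fun s => (hY s).aemeasurable)
      fun s => by fun_prop
  simp only [columnEstimator_sub_column_eq_sum hN hη r]
  have hm : AEMeasurable (fun ω => ∑ k, shotError η r S Y (i, k) ω) P := by fun_prop
  refine ⟨hm, ?_⟩
  have := Measure.isProbabilityMeasure_map hm
  refine Measure.ext_of_charFun (funext fun t => ?_)
  rw [(hind'.precomp (g := fun k => (i, k))
    (Prod.mk_right_injective i)).charFun_map_fun_sum_eq_prod fun k => hZ (i, k),
    Finset.prod_apply, charFun_multivariateGaussian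
      ((posSemidef_noiseCov S).smul (by positivity)), inner_zero_right]
  simp only [charFun_shotError (hY _)]
  -- All 2N factors agree, the sign entering only squared, and 2N · (2ηN)⁻² = (2η²N)⁻¹.
  rw [Finset.prod_const, ← Complex.exp_nat_mul, Finset.card_univ, Fintype.card_prod,
    Fintype.card_fin, Fintype.card_units_int, Matrix.smul_mulVec, dotProduct_smul, smul_eq_mul]
  have hN' : (N : ℂ) ≠ 0 := by exact_mod_cast hN.ne'
  have hη' : (η : ℂ) ≠ 0 := by exact_mod_cast hη.ne'
  congr 1
  push_cast
  field_simp
  ring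

lemma iIndepFun_columnEstimator_sub_column (hN : 0 < N) {η : ℝ} (hη : 0 < η) (r : Phase m)
    {S : PMatrix m} {Y : SymShot m N → Ω → Phase m} (hind : iIndepFun Y P)
    (hY : ∀ s, AEMeasurable (Y s) P) :
    iIndepFun (fun (i : Fin m ⊕ Fin m) ω => columnEstimator η Y i ω - column S i) P := by
  simp only [columnEstimator_sub_column_eq_sum hN hη r]
  refine iIndepFun_sum_of_iIndepFun (fun s => ?_) ?_
  · have := hY s
    unfold shotError; fun_prop
  · exact hind.comp₀ (fun s y => (((s.2.1 : ℤ) : ℝ) * (2 * η * N)⁻¹) •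
      (y - (r + (((s.2.1 : ℤ) : ℝ) * η) • column S s.1))) hY fun s => by fun_prop

end ColumnErrors

-- Operator norm of the noise covariance.

section OperatorNorm

open scoped MatrixOrder

variable {m : ℕ}

lemma norm_act_le (A : PMatrix m) (x : Phase m) : ‖act A x‖ ≤ opNorm A * ‖x‖ :=
  (Matrix.toEuclideanCLM (𝕜 := ℝ) A).le_opNorm x

lemma opNorm_nonneg (A : PMatrix m) : 0 ≤ opNorm A := norm_nonneg _

lemma opNorm_mul_le (A B : PMatrix m) : opNorm (A * B) ≤ opNorm A * opNorm B := by
  unfold opNorm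
  rw [map_mul]
  exact norm_mul_le _ _

lemma opNorm_transpose (A : PMatrix m) : opNorm A.transpose = opNorm A := by
  unfold opNorm
  rw [← Matrix.conjTranspose_eq_transpose_of_trivial, ← Matrix.star_eq_conjTranspose, map_star,
    ContinuousLinearMap.star_eq_adjoint, LinearIsometryEquiv.norm_map]

lemma continuous_opNorm : Continuous (opNorm : PMatrix m → ℝ) :=
  (LinearMap.continuous_of_finiteDimensional
    (Matrix.toEuclideanCLM (n := Fin m ⊕ Fin m) (𝕜 := ℝ)).toAlgEquiv.toLinearMap).norm

lemma norm_act_J (x : Phase m) : ‖act (Matrix.J (Fin m) ℝ) x‖ = ‖x‖ := by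
  rw [← sq_eq_sq₀ (norm_nonneg _) (norm_nonneg _), norm_sq_eq_posPart_add_momPart,
    norm_sq_eq_posPart_add_momPart x, posPart_act_J, momPart_act_J, norm_neg, add_comm]

/-- S J Sᵀ = J is an isometry, which forces ‖S‖ ≥ 1. The vector form remains valid for m = 0, where
‖S‖ = 0. -/
lemma norm_le_opNorm_sq_mul_norm {S : PMatrix m} (hS : S ∈ Matrix.symplecticGroup (Fin m) ℝ)
    (x : Phase m) : ‖x‖ ≤ opNorm S ^ 2 * ‖x‖ := by
  calc ‖x‖ = ‖act S (act (Matrix.J (Fin m) ℝ) (act S.transpose x))‖ := by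
        rw [← act_mul, ← act_mul, SymplecticGroup.mem_iff.1 hS, norm_act_J]
    _ ≤ opNorm S * (opNorm S * ‖x‖) := by
        refine (norm_act_le _ _).trans (mul_le_mul_of_nonneg_left ?_ (opNorm_nonneg S))
        rw [norm_act_J, ← opNorm_transpose]
        exact norm_act_le _ _
    _ = _ := by ring

lemma norm_sq_act_sqrt {A : PMatrix m} (hA : A.PosSemidef) (x : Phase m) :
    ‖act (CFC.sqrt A) x‖ ^ 2 = x.ofLp ⬝ᵥ A.mulVec x.ofLp := by
  have hsa : IsSelfAdjoint (Matrix.toEuclideanCLM (𝕜 := ℝ) (CFC.sqrt A)) :=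
    (CFC.sqrt_nonneg A).isSelfAdjoint.map _
  rw [← Matrix.inner_toEuclideanCLM, ← real_inner_self_eq_norm_sq]
  conv_rhs => rw [← CFC.sqrt_mul_sqrt_self A hA.nonneg, map_mul]
  change _ = ⟪x, Matrix.toEuclideanCLM (𝕜 := ℝ) (CFC.sqrt A) (act (CFC.sqrt A) x)⟫
  rw [← ContinuousLinearMap.adjoint_inner_left, hsa.adjoint_eq]
  rfl

/-- The quadratic form of Σ is at most ½(‖S‖² + 1)‖x‖² ≤ ‖S‖²‖x‖², so the vacuum term costs no
additional constant. -/
lemma opNorm_sqrt_smul_noiseCov_le {S : PMatrix m} (hS : S ∈ Matrix.symplecticGroup (Fin m) ℝ)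
    {c : ℝ} (hc : 0 ≤ c) : opNorm (CFC.sqrt (c • noiseCov S)) ≤ √c * opNorm S := by
  refine ContinuousLinearMap.opNorm_le_bound _ (by have := opNorm_nonneg S; positivity)
    fun x => ?_
  have h1 := norm_sq_act_sqrt ((posSemidef_noiseCov S).smul hc) x
  rw [Matrix.smul_mulVec, dotProduct_smul, smul_eq_mul, quadForm_noiseCov] at h1
  have h2 : ‖act S.transpose x‖ ^ 2 ≤ (opNorm S * ‖x‖) ^ 2 := by
    gcongr
    rw [← opNorm_transpose]
    exact norm_act_le _ _
  have h3 : ‖x‖ ^ 2 ≤ (opNorm S * ‖x‖) ^ 2 := by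
    have := mul_le_mul_of_nonneg_right (norm_le_opNorm_sq_mul_norm hS x) (norm_nonneg x)
    linarith
  change ‖act (CFC.sqrt (c • noiseCov S)) x‖ ≤ _
  refine abs_le_of_sq_le_sq' ?_ (by have := opNorm_nonneg S; positivity) |>.2
  rw [h1, mul_assoc, mul_pow, Real.sq_sqrt hc]
  gcongr
  linarith

end OperatorNorm

-- Matrices with independent correlated Gaussian columns.

section GaussianColumns

open scoped MatrixOrder

variable {m : ℕ}

lemma map_column_gaussMatrix :
    (stdGaussian (MatrixVectorSpace (Fin m ⊕ Fin m))).map (fun z i => column (gaussMatrix z) i) =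
      Measure.pi fun _ => stdGaussian (Phase m) := by
  have hm : Measurable fun (z : MatrixVectorSpace (Fin m ⊕ Fin m)) i =>
      column (gaussMatrix z) i := by
    unfold column gaussMatrix
    fun_prop
  have := Measure.isProbabilityMeasure_map
    (μ := stdGaussian (MatrixVectorSpace (Fin m ⊕ Fin m))) hm.aemeasurable
  refine charFun_eq_pi_iff.1 fun t => ?_
  -- The tuple of test vectors placed in the matrix block, with zero on the auxiliary vectors; its
  -- squared norm splits over the columns.
  set w : MatrixVectorSpace (Fin m ⊕ Fin m) :=
    WithLp.toLp 2 (Sum.elim (fun ij => t ij.2 ij.1) 0)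
  have h := charFun_stdGaussian w
  have hw : ‖w‖ ^ 2 = ∑ i, ‖t i‖ ^ 2 := by
    simp only [EuclideanSpace.real_norm_sq_eq, w]
    rw [Fintype.sum_sum_type, Fintype.sum_prod_type, Finset.sum_comm]
    simp
  simp only [charFun_stdGaussian]
  rw [← Complex.exp_sum, ← Finset.sum_div, Finset.sum_neg_distrib, charFun_apply,
    Measure.map_map (WithLp.measurable_toLp 2 _) hm,
    integral_map ((WithLp.measurable_toLp 2 _).comp hm).aemeasurable (by fun_prop)]
  have hw' : (‖w‖ ^ 2 : ℂ) = ∑ i, (‖t i‖ ^ 2 : ℂ) := by exact_mod_cast hw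
  rw [← hw', ← h, charFun_apply]
  congr 1; ext z
  congr 3
  have h1 : ⟪z, w⟫ = ∑ i, ∑ j, t i j * z (Sum.inl (j, i)) := by
    rw [PiLp.inner_apply, Fintype.sum_sum_type, Fintype.sum_prod_type, Finset.sum_comm]
    simp [w]
  rw [h1]
  simp [PiLp.inner_apply, column, gaussMatrix]

lemma map_act_sqrt_column_gaussMatrix (A : PMatrix m) :
    (stdGaussian (MatrixVectorSpace (Fin m ⊕ Fin m))).map
      (fun z i => act (CFC.sqrt A) (column (gaussMatrix z) i)) =
      Measure.pi fun _ => multivariateGaussian 0 A := by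
  have hm : Measurable fun (z : MatrixVectorSpace (Fin m ⊕ Fin m)) i =>
      column (gaussMatrix z) i := by
    unfold column gaussMatrix
    fun_prop
  have h : (multivariateGaussian 0 A : Measure (Phase m)) =
      (stdGaussian (Phase m)).map (act (CFC.sqrt A)) := by
    simp only [multivariateGaussian, zero_add]
    rfl
  have ha : Measurable (act (CFC.sqrt A)) := by unfold act; fun_prop
  have : IsProbabilityMeasure ((stdGaussian (Phase m)).map (act (CFC.sqrt A))) :=
    Measure.isProbabilityMeasure_map ha.aemeasurable
  rw [h, ← Measure.pi_map_pi fun _ => ha.aemeasurable, ← map_column_gaussMatrix,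
    Measure.map_map (by fun_prop) hm]
  rfl

/-- A matrix with independent Gaussian columns of covariance `c • noiseCov S` has small operator
norm with high probability. -/
lemma pi_multivariateGaussian_opNorm_gt_le {S : PMatrix m}
    (hS : S ∈ Matrix.symplecticGroup (Fin m) ℝ) {c : ℝ} (hc : 0 ≤ c) {τ : ℝ} (hτ : 0 < τ) {ε : ℝ}
    (hε : 0 ≤ ε) (h : √c * opNorm S * (2 * √(2 * (m : ℝ)) + τ) ≤ ε) :
    (Measure.pi fun _ : Fin m ⊕ Fin m => multivariateGaussian 0 (c • noiseCov S))
      {x | ε < opNorm (Matrix.of fun a i => x i a)} ≤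
      ENNReal.ofReal (Real.exp (-τ ^ 2 / 2)) := by
  -- The Gaussian matrix bound needs a nonempty index type; for m = 0 every operator norm vanishes.
  rcases Nat.eq_zero_or_pos m with rfl | hm
  · have hempty : {x : Fin 0 ⊕ Fin 0 → Phase 0 | ε < opNorm (Matrix.of fun a i => x i a)} = ∅ := by
      ext x
      simp [opNorm, hε]
    rw [hempty, measure_empty]
    exact zero_le
  have : Nonempty (Fin m ⊕ Fin m) := ⟨Sum.inl ⟨0, hm⟩⟩
  have hmeas : MeasurableSet {x : Fin m ⊕ Fin m → Phase m |
      ε < opNorm (Matrix.of fun a i => x i a)} := by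
    refine (isOpen_lt continuous_const (continuous_opNorm.comp ?_)).measurableSet
    exact continuous_matrix fun a i => by simp only [Matrix.of_apply]; fun_prop
  rw [← map_act_sqrt_column_gaussMatrix, Measure.map_apply ?_ hmeas]
  · refine (measure_mono fun z hz => ?_).trans (stdGaussian_norm_gaussMatrix_gt_le hτ)
    by_contra hcon
    have hcard : (Fintype.card (Fin m ⊕ Fin m) : ℝ) = 2 * m := by simp; ring
    have hcon' : opNorm (gaussMatrix z) ≤ 2 * √(2 * (m : ℝ)) + τ := by
      rw [← hcard]; exact not_lt.1 hcon
    have hz' : ε < opNorm (Matrix.of fun a i =>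
      act (CFC.sqrt (c • noiseCov S)) (column (gaussMatrix z) i) a) := hz
    refine (not_le.2 hz') ?_
    have hmul : (Matrix.of fun a i => act (CFC.sqrt (c • noiseCov S)) (column (gaussMatrix z) i) a) =
        CFC.sqrt (c • noiseCov S) * gaussMatrix z := by
      ext a i
      simp [act_apply, Matrix.mul_apply, column]
    rw [hmul]
    refine (opNorm_mul_le _ _).trans (le_trans ?_ h)
    exact mul_le_mul (opNorm_sqrt_smul_noiseCov_le hS hc) hcon' (opNorm_nonneg _)
      (mul_nonneg (Real.sqrt_nonneg _) (opNorm_nonneg _))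
  · unfold column gaussMatrix act
    fun_prop

end GaussianColumns

end CV

end

-- Assembly of the theorem.

theorem mainTheorem5 {m N : ℕ} (hN : 0 < N) {η : ℝ} (hη : 0 < η)
    (r : CV.Phase m) (S : CV.PMatrix m) (hS : S ∈ Matrix.symplecticGroup (Fin m) ℝ)
    (G : CV.Hilb m ≃ₗᵢ[ℂ] CV.Hilb m) (hG : CV.IsGaussianUnitary r S G)
    {Ω : Type*} [MeasurableSpace Ω] (P : Measure Ω) [IsProbabilityMeasure P]
    (Y : CV.SymShot m N → Ω → CV.Phase m)
    (hY : (CV.symmetricScheme m N η).IsRecord G P Y) :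
    -- each outcome of the probe `|σ η e_i⟩` is Gaussian with the stated mean and covariance
    (∀ (i : Fin m ⊕ Fin m) (σ : ℤˣ) (k : Fin N),
      HasLaw (Y (i, σ, k))
        (multivariateGaussian (r + (((σ : ℤ) : ℝ) * η) • CV.column S i) (CV.noiseCov S)) P) ∧
    -- the column errors are centred Gaussian vectors
    (∀ i : Fin m ⊕ Fin m,
      HasLaw (fun ω => CV.columnEstimator η Y i ω - CV.column S i)
        (multivariateGaussian 0 ((2 * η ^ 2 * (N : ℝ))⁻¹ • CV.noiseCov S)) P) ∧
    -- and they are mutually independent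
    iIndepFun (fun (i : Fin m ⊕ Fin m) (ω : Ω) => CV.columnEstimator η Y i ω - CV.column S i) P ∧
    -- high-probability bound on the operator-norm error
    (∀ ε δ : ℝ, 0 < ε → 0 < δ → δ < 1 →
      CV.opNorm S ^ 2 * (2 * √(2 * (m : ℝ)) + √(2 * Real.log (1 / δ))) ^ 2
          / (2 * η ^ 2 * ε ^ 2) ≤ (N : ℝ) →
      1 - δ ≤ P.real {ω | CV.opNorm (CV.matrixEstimator η Y ω - S) ≤ ε}) ∧
    -- total number of uses of the unitary
    (CV.symmetricScheme m N η).queryCount = 4 * m * N := by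
  have hind : iIndepFun Y P := hY.1
  have hlaw : ∀ s : CV.SymShot m N, HasLaw (Y s) (multivariateGaussian
      (r + (((s.2.1 : ℤ) : ℝ) * η) • CV.column S s.1) (CV.noiseCov S)) P := fun s => by
    have h : HasLaw (Y s)
      (CV.heterodyneLaw (G (CV.coherent
        (EuclideanSpace.single s.1 (((s.2.1 : ℤ) : ℝ) * η))))) P := hY.2 s
    rwa [CV.heterodyneLaw_gaussianUnitary hS hG, CV.act_single] at h
  have hcol := CV.hasLaw_columnEstimator_sub_column hN hη hind hlaw
  have hcolind := CV.iIndepFun_columnEstimator_sub_column (S := S) hN hη r hind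
    fun s => (hlaw s).aemeasurable
  refine ⟨fun i σ k => hlaw (i, σ, k), hcol, hcolind, fun ε δ hε hδ hδ1 hNbound => ?_, ?_⟩
  · set τ := √(2 * Real.log (1 / δ)) with hτdef
    set c := (2 * η ^ 2 * (N : ℝ))⁻¹ with hc
    have hN' : (0 : ℝ) < N := by exact_mod_cast hN
    have hc0 : 0 ≤ c := by positivity
    have hlog : 0 < Real.log (1 / δ) := Real.log_pos (by rw [lt_div_iff₀ hδ]; linarith)
    have hτ : 0 < τ := Real.sqrt_pos.2 (by linarith)
    -- τ is chosen so that the Gaussian tail equals δ; δ < 1 makes τ positive.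
    have hexp : Real.exp (-τ ^ 2 / 2) = δ := by
      rw [hτdef, Real.sq_sqrt (by linarith), one_div, Real.log_inv]
      rw [show -(2 * -Real.log δ) / 2 = Real.log δ by ring, Real.exp_log hδ]
    have hbound : √c * CV.opNorm S * (2 * √(2 * (m : ℝ)) + τ) ≤ ε := by
      refine abs_le_of_sq_le_sq' ?_ hε.le |>.2
      rw [mul_pow, mul_pow, Real.sq_sqrt hc0, hc]
      rw [div_le_iff₀ (by positivity)] at hNbound
      rw [mul_assoc, inv_mul_le_iff₀ (by positivity)]
      linarith
    have htail := CV.pi_multivariateGaussian_opNorm_gt_le hS hc0 hτ hε.le hbound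
    rw [hexp] at htail
    have hm : AEMeasurable (fun ω (i : Fin m ⊕ Fin m) =>
        CV.columnEstimator η Y i ω - CV.column S i) P :=
      aemeasurable_pi_lambda _ fun i => (hcol i).aemeasurable
    -- Independence makes the joint law of the columns a product measure, to which the matrix tail
    -- bound applies.
    have hjoint := (iIndepFun_iff_map_fun_eq_pi_map fun i => (hcol i).aemeasurable).1 hcolind
    simp only [(hcol _).map_eq] at hjoint
    have hopen : MeasurableSet {x : Fin m ⊕ Fin m → CV.Phase m |
        ε < CV.opNorm (Matrix.of fun a i => x i a)} := by
      refine (isOpen_lt continuous_const (CV.continuous_opNorm.comp ?_)).measurableSet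
      exact continuous_matrix fun a i => by simp only [Matrix.of_apply]; fun_prop
    rw [← hjoint, Measure.map_apply_of_aemeasurable hm hopen] at htail
    have hcompl : {ω | CV.opNorm (CV.matrixEstimator η Y ω - S) ≤ ε} =
        ((fun ω (i : Fin m ⊕ Fin m) => CV.columnEstimator η Y i ω - CV.column S i) ⁻¹'
          {x | ε < CV.opNorm (Matrix.of fun a i => x i a)})ᶜ := by
      ext ω
      rw [Set.mem_compl_iff, Set.mem_preimage, Set.mem_ofPred_eq, Set.mem_ofPred_eq, not_lt]
      rfl
    rw [hcompl, probReal_compl_eq_one_sub₀ (hm.nullMeasurableSet_preimage hopen)]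
    have := ENNReal.toReal_le_of_le_ofReal hδ.le htail
    rw [Measure.real]
    linarith
  · change Fintype.card ((Fin m ⊕ Fin m) × ℤˣ × Fin N) = _
    simp only [Fintype.card_prod, Fintype.card_sum, Fintype.card_fin, Fintype.card_units_int]
    ring
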